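/- Let $a>0$, $a\neq 1$, and let $M_a^2=\{(x,y,z)\in\mathbb R^3 : x^2+y^2=a^2(1-z^2)\}$ carry the Riemannian metric induced by $\mathbb R^3$. Functions and vector fields are smooth. Let $r$ be the signed arc length along the meridians, measured from the equator, with values in $[-d,d]$ ($\pm d$ at the poles), let $\theta$ be the angle of rotation about the $z$-axis, and let $\partial_\theta=(-y,x,0)$ (which vanishes at the poles). A vector field $Z$ on a Riemannian manifold is called a zonal flow if (1) $Z=fX$ for a function $f$ and a Killing vector field $X$; (2) $\operatorname{div}Z=0$; (3) $P(\nabla_ZZ)=0$, where $P$ is the $L^2$-orthogonal projection onto the divergence-free vector fields, i.e. $P(V)$ is the divergence-free field of the form $V-\operatorname{grad}q$ with a function $q$. A zonal flow $Z$ is geodesic if $\nabla_ZZ=0$ and non-geodesic otherwise. It is an $S^1$-zonal flow if it can be written as $Z=fX$ with a function $f$ and a Killing vector field $X$ that is induced by a smooth $S^1$-action, i.e. $X(p)=\frac{d}{dt}\big|_{t=0}e^{it}\cdot p$. Then, for every $Z:M_a^2\to\mathbb R^3$: (i) $Z$ is a zonal flow on $M_a^2$ if and only if $Z$ is a smooth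 vector field on $M_a^2$ of the form $Z=f(r)\,\partial_\theta$ with a function $f$ of the one variable $r$ that is smooth on $(-d,d)$ (the earlier notion of a zonal flow on the ellipsoid). (ii) Every zonal flow $Z$ on $M_a^2$ that is not identically zero is a non-geodesic $S^1$-zonal flow. -/

import Mathlib

open Set
open scoped RealInnerProductSpace ContDiff

noncomputable section

namespace ZonalFlow

/-! ### Riemannian geometry of an embedded submanifold `S` of Euclidean space

`S ⊆ ℝⁿ` carries the metric induced by `ℝⁿ`.  Functions and vector fields on `S` are maps on `ℝⁿ`
of which only the values on `S` matter; they are smooth on `S` when they are `C^∞` along `S`. -/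

section Submanifold

variable {n : ℕ}

/-- The tangent space `T_p S`. -/
def tangentSpaceAt (S : Set (EuclideanSpace ℝ (Fin n))) (p : EuclideanSpace ℝ (Fin n)) :
    Submodule ℝ (EuclideanSpace ℝ (Fin n)) :=
  Submodule.span ℝ (tangentConeAt ℝ S p)

/-- The derivative along `S` of a map on `S` is well defined on tangent vectors, so that
`fderivWithin ℝ F S p v` with `v ∈ T_p S` is the derivative of `F : S → G` at `p` in direction `v`. -/
theorem hasFDerivWithinAt_unique_on_tangentSpaceAt {G : Type*} [NormedAddCommGroup G]
    [NormedSpace ℝ G] {S : Set (EuclideanSpace ℝ (Fin n))} {p : EuclideanSpace ℝ (Fin n)}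
    {F : EuclideanSpace ℝ (Fin n) → G} {A B : EuclideanSpace ℝ (Fin n) →L[ℝ] G}
    (hA : HasFDerivWithinAt F A S p) (hB : HasFDerivWithinAt F B S p)
    {v : EuclideanSpace ℝ (Fin n)} (hv : v ∈ tangentSpaceAt S p) : A v = B v :=
  LinearMap.eqOn_span (f := (A : EuclideanSpace ℝ (Fin n) →ₗ[ℝ] G))
    (g := (B : EuclideanSpace ℝ (Fin n) →ₗ[ℝ] G)) (hA.unique_on hB) hv

/-- Smooth real functions on `S`. -/
def IsSmoothFunction (S : Set (EuclideanSpace ℝ (Fin n))) (f : EuclideanSpace ℝ (Fin n) → ℝ) :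
    Prop :=
  ContDiffOn ℝ ∞ f S

/-- Smooth (tangent) vector fields on `S`. -/
def IsVectorField (S : Set (EuclideanSpace ℝ (Fin n)))
    (V : EuclideanSpace ℝ (Fin n) → EuclideanSpace ℝ (Fin n)) : Prop :=
  ContDiffOn ℝ ∞ V S ∧ ∀ p ∈ S, V p ∈ tangentSpaceAt S p

/-- The gradient on `S` of a function: the tangent vector at `p` that represents its differential. -/
def grad (S : Set (EuclideanSpace ℝ (Fin n))) (f : EuclideanSpace ℝ (Fin n) → ℝ)
    (p : EuclideanSpace ℝ (Fin n)) : EuclideanSpace ℝ (Fin n) :=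
  (tangentSpaceAt S p).starProjection (gradientWithin f S p)

/-- The Levi-Civita connection of the induced metric: `cov S V p v` is `∇_v V` at `p`, the
tangential part of the derivative of `V` in the direction `v ∈ T_p S`. -/
def cov (S : Set (EuclideanSpace ℝ (Fin n)))
    (V : EuclideanSpace ℝ (Fin n) → EuclideanSpace ℝ (Fin n)) (p v : EuclideanSpace ℝ (Fin n)) :
    EuclideanSpace ℝ (Fin n) :=
  (tangentSpaceAt S p).starProjection (fderivWithin ℝ V S p v)

/-- The divergence on `S`: the trace of the endomorphism `v ↦ ∇_v V` of `T_p S`. -/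
def divergence (S : Set (EuclideanSpace ℝ (Fin n)))
    (V : EuclideanSpace ℝ (Fin n) → EuclideanSpace ℝ (Fin n)) (p : EuclideanSpace ℝ (Fin n)) : ℝ :=
  LinearMap.trace ℝ (tangentSpaceAt S p)
    (((tangentSpaceAt S p).orthogonalProjectionOnto ∘L fderivWithin ℝ V S p ∘L
      (tangentSpaceAt S p).subtypeL : tangentSpaceAt S p →L[ℝ] tangentSpaceAt S p) :
      tangentSpaceAt S p →ₗ[ℝ] tangentSpaceAt S p)

/-- Divergence-free vector fields on `S`. -/
def IsDivergenceFree (S : Set (EuclideanSpace ℝ (Fin n)))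
    (V : EuclideanSpace ℝ (Fin n) → EuclideanSpace ℝ (Fin n)) : Prop :=
  IsVectorField S V ∧ ∀ p ∈ S, divergence S V p = 0

/-- Killing vector fields on `S`: `g(∇_v X, w) = - g(∇_w X, v)`. -/
def IsKilling (S : Set (EuclideanSpace ℝ (Fin n)))
    (X : EuclideanSpace ℝ (Fin n) → EuclideanSpace ℝ (Fin n)) : Prop :=
  IsVectorField S X ∧ ∀ p ∈ S, ∀ v ∈ tangentSpaceAt S p, ∀ w ∈ tangentSpaceAt S p,
    ⟪cov S X p v, w⟫ = -⟪cov S X p w, v⟫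

/-- `W = P(V)` for the `L²`-orthogonal projection `P` onto the divergence-free fields:
`W` is divergence-free and `W = V - grad q` for a smooth function `q` on `S`. -/
def IsLerayProjection (S : Set (EuclideanSpace ℝ (Fin n)))
    (V W : EuclideanSpace ℝ (Fin n) → EuclideanSpace ℝ (Fin n)) : Prop :=
  IsDivergenceFree S W ∧ ∃ q, IsSmoothFunction S q ∧ ∀ p ∈ S, W p = V p - grad S q p

/-- Zonal flows on `S`: vector fields `Z` with `Z = f X` for a smooth function `f` and a Killing
field `X`, with `div Z = 0` and `P(∇_Z Z) = 0`. -/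
def IsZonal (S : Set (EuclideanSpace ℝ (Fin n)))
    (Z : EuclideanSpace ℝ (Fin n) → EuclideanSpace ℝ (Fin n)) : Prop :=
  (∃ f X, IsSmoothFunction S f ∧ IsKilling S X ∧ ∀ p ∈ S, Z p = f p • X p) ∧
  IsDivergenceFree S Z ∧
  IsLerayProjection S (fun p => cov S Z p (Z p)) 0

/-- Geodesic zonal flows: zonal flows `Z` with `∇_Z Z = 0`. -/
def IsGeodesicZonal (S : Set (EuclideanSpace ℝ (Fin n)))
    (Z : EuclideanSpace ℝ (Fin n) → EuclideanSpace ℝ (Fin n)) : Prop :=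
  IsZonal S Z ∧ ∀ p ∈ S, cov S Z p (Z p) = 0

/-- Smooth actions of the circle group `S¹` on `S`. -/
structure IsCircleAction (S : Set (EuclideanSpace ℝ (Fin n)))
    (ρ : Circle → EuclideanSpace ℝ (Fin n) → EuclideanSpace ℝ (Fin n)) : Prop where
  mapsTo : ∀ s, MapsTo (ρ s) S S
  one : ∀ p ∈ S, ρ 1 p = p
  mul : ∀ s t, ∀ p ∈ S, ρ (s * t) p = ρ s (ρ t p)
  smooth : ContDiffOn ℝ ∞
    (fun x : ℝ × EuclideanSpace ℝ (Fin n) => ρ (Circle.exp x.1) x.2) (univ ×ˢ S)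

/-- `X` is induced by an `S¹`-action on `S`: `X p` is the velocity of `t ↦ e^{it} · p` at `0`. -/
def IsInducedByCircleAction (S : Set (EuclideanSpace ℝ (Fin n)))
    (X : EuclideanSpace ℝ (Fin n) → EuclideanSpace ℝ (Fin n)) : Prop :=
  ∃ ρ, IsCircleAction S ρ ∧ ∀ p ∈ S, HasDerivAt (fun t : ℝ => ρ (Circle.exp t) p) (X p) 0

/-- `S¹`-zonal flows: zonal flows `Z = f X` whose Killing field `X` is induced by an `S¹`-action. -/
def IsCircleZonal (S : Set (EuclideanSpace ℝ (Fin n)))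
    (Z : EuclideanSpace ℝ (Fin n) → EuclideanSpace ℝ (Fin n)) : Prop :=
  IsZonal S Z ∧ ∃ f X, IsSmoothFunction S f ∧ IsKilling S X ∧ (∀ p ∈ S, Z p = f p • X p) ∧
    IsInducedByCircleAction S X

end Submanifold

/-! ### The two-dimensional ellipsoid -/

/-- `M_a² = {x² + y² = a² (1 - z²)} ⊆ ℝ³`. -/
def ellipsoid (a : ℝ) : Set (EuclideanSpace ℝ (Fin 3)) :=
  {p | p 0 ^ 2 + p 1 ^ 2 = a ^ 2 * (1 - p 2 ^ 2)}

/-- Arc length, measured from the equator, of the meridian `τ ↦ (a cos τ, sin τ)` up to `τ = t`. -/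
def meridianArc (a t : ℝ) : ℝ :=
  ∫ τ in (0 : ℝ)..t, √(a ^ 2 * Real.sin τ ^ 2 + Real.cos τ ^ 2)

/-- The number `d`, half of the length of a meridian from pole to pole. -/
def halfMeridian (a : ℝ) : ℝ := meridianArc a (Real.pi / 2)

/-- The coordinate `r` on the ellipsoid: the signed arc length along the meridian from the equator;
it takes the values `-d` and `d` at the poles and values in `(-d, d)` elsewhere. -/
def rCoord (a : ℝ) (p : EuclideanSpace ℝ (Fin 3)) : ℝ := meridianArc a (Real.arcsin (p 2))

/-- The coordinate field `∂_θ`: as `θ` is the angle of rotation about the `z`-axis,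
`∂_θ = (-y, x, 0)`, extended by `0` to the poles. -/
def dTheta (p : EuclideanSpace ℝ (Fin 3)) : EuclideanSpace ℝ (Fin 3) := !₂[-p 1, p 0, 0]

/-- Vector fields on the ellipsoid of the form `f(r) ∂_θ` with `f` a smooth function of the one
variable `r ∈ (-d, d)`. -/
def IsProfileField (a : ℝ) (Z : EuclideanSpace ℝ (Fin 3) → EuclideanSpace ℝ (Fin 3)) : Prop :=
  IsVectorField (ellipsoid a) Z ∧
  ∃ f : ℝ → ℝ, ContDiffOn ℝ ∞ f (Ioo (-halfMeridian a) (halfMeridian a)) ∧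
    ∀ p ∈ ellipsoid a, Z p = f (rCoord a p) • dTheta p

end ZonalFlow

end

noncomputable section

/-! ### Smooth dependence of integrals on parameters -/

section ParametricIntegral

open MeasureTheory intervalIntegral Filter Topology

/-! When `a ≠ 1`, every Killing field of the ellipsoid is a constant multiple of `∂_θ`
(`IsKilling.exists_eq_smul_dTheta`). Meridians are geodesics up to parametrization, so the component
of a Killing field along the unit tangent of a meridian is constant and is read off at the north
pole. Integrating the remaining Killing equations and comparing them on the equator gives `(a² - 1)`
times the horizontal part of the field at the pole equal to zero. So the field is tangent to the
parallels, and the last equation fixes its size up to a constant.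

Hence a zonal flow is `g ∂_θ`, and since `div (g ∂_θ) = dg(∂_θ)`, being divergence-free means that
`g` is rotation invariant (`IsInvariantFactor`). Conversely, for such `g` the derivative of `Z`
along itself is `g² ∂_θ(∂_θ)`, whose tangential part is the gradient of a primitive of `a² z g² dz`.
So `g ∂_θ` is zonal, and `∂_θ` comes from the rotation action. Its self-derivative has meridional
component `a² g² sin τ cos τ`, up to normalization; if that vanishes, then `g = 0` off the equator
and the poles, and by continuity everywhere.

It remains to match invariant factors with profiles `f(r)`. From `g` to `f` one inverts the arc
length. From `f` to `g` the issue is smoothness at the poles: the `y`-component of `Z` is `x f(r)`,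
and Hadamard's lemma divides it by `x` smoothly (`exists_factor_near_poles`). -/

theorem exists_bound_of_continuousOn_prod_univ {E G : Type*} [NormedAddCommGroup E]
    [ProperSpace E] [NormedAddCommGroup G] {U : Set E} (hU : IsOpen U) {F : E × ℝ → G}
    (hF : ContinuousOn F (U ×ˢ univ)) {x₀ : E} (hx₀ : x₀ ∈ U) (a b : ℝ) :
    ∃ s ∈ 𝓝 x₀, s ⊆ U ∧ ∃ C : ℝ, ∀ x ∈ s, ∀ t ∈ uIcc a b, ‖F (x, t)‖ ≤ C := by
  obtain ⟨ε, hε, hεU⟩ := Metric.nhds_basis_closedBall.mem_iff.1 (hU.mem_nhds hx₀)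
  have hK : IsCompact (Metric.closedBall x₀ ε ×ˢ uIcc a b) :=
    (isCompact_closedBall x₀ ε).prod isCompact_uIcc
  obtain ⟨C, hC⟩ := hK.exists_bound_of_continuousOn
    (hF.mono (prod_mono hεU (subset_univ _)))
  exact ⟨_, Metric.closedBall_mem_nhds x₀ hε, hεU, C, fun x hx t ht => hC (x, t) ⟨hx, ht⟩⟩

theorem continuous_slice {E G : Type*} [TopologicalSpace E] [TopologicalSpace G] {U : Set E} {F : E × ℝ → G} (hF : ContinuousOn F (U ×ˢ univ)) {x : E}
    (hx : x ∈ U) : Continuous fun t : ℝ => F (x, t) :=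
  hF.comp_continuous (by fun_prop) fun _ => ⟨hx, mem_univ _⟩

theorem continuousOn_intervalIntegral {E G : Type*} [NormedAddCommGroup E] [ProperSpace E]
    [NormedAddCommGroup G] [NormedSpace ℝ G] {U : Set E} (hU : IsOpen U) {F : E × ℝ → G}
    (hF : ContinuousOn F (U ×ˢ univ)) (a b : ℝ) :
    ContinuousOn (fun x => ∫ t in a..b, F (x, t)) U := by
  intro x₀ hx₀
  obtain ⟨s, hs, hsU, C, hC⟩ := exists_bound_of_continuousOn_prod_univ hU hF hx₀ a b
  apply ContinuousAt.continuousWithinAt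
  refine continuousAt_of_dominated_interval (bound := fun _ => C) ?_ ?_ ?_ ?_
  · filter_upwards [hs] with x hx
    exact (continuous_slice hF (hsU hx)).aestronglyMeasurable
  · filter_upwards [hs] with x hx
    exact ae_of_all _ fun t ht => hC x hx t (uIoc_subset_uIcc ht)
  · exact intervalIntegrable_const
  · refine ae_of_all _ fun t _ => ?_
    have h := (hF.continuousAt ((hU.prod isOpen_univ).mem_nhds
      (show (x₀, t) ∈ U ×ˢ (univ : Set ℝ) from ⟨hx₀, mem_univ _⟩)))
    exact ContinuousAt.comp (f := fun x => (x, t)) h (by fun_prop)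

variable {E G : Type} [NormedAddCommGroup E] [NormedSpace ℝ E] [ProperSpace E]
  [NormedAddCommGroup G] [NormedSpace ℝ G]

theorem hasFDerivAt_intervalIntegral {U : Set E} (hU : IsOpen U) {F : E × ℝ → G}
    (hF : ContDiffOn ℝ 1 F (U ×ˢ univ)) (a b : ℝ) {x₀ : E} (hx₀ : x₀ ∈ U) :
    HasFDerivAt (fun x => ∫ t in a..b, F (x, t))
      (∫ t in a..b, (fderiv ℝ F (x₀, t)).comp (ContinuousLinearMap.inl ℝ E ℝ)) x₀ := by
  have hop : IsOpen (U ×ˢ (univ : Set ℝ)) := hU.prod isOpen_univ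
  have hF' : ContinuousOn (fun y => (fderiv ℝ F y).comp (ContinuousLinearMap.inl ℝ E ℝ))
      (U ×ˢ univ) :=
    (hF.continuousOn_fderiv_of_isOpen hop le_rfl).clm_comp continuousOn_const
  obtain ⟨s, hs, hsU, C, hC⟩ := exists_bound_of_continuousOn_prod_univ hU hF' hx₀ a b
  refine hasFDerivAt_integral_of_dominated_of_fderiv_le
    (F := fun x t => F (x, t))
    (F' := fun x t => (fderiv ℝ F (x, t)).comp (ContinuousLinearMap.inl ℝ E ℝ)) hs
    (bound := fun _ => C) ?_ ?_ ?_ ?_ ?_ ?_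
  · filter_upwards [hs] with x hx
    exact (continuous_slice hF.continuousOn (hsU hx)).aestronglyMeasurable
  · exact (continuous_slice hF.continuousOn hx₀).intervalIntegrable _ _
  · exact (continuous_slice hF' hx₀).aestronglyMeasurable
  · exact ae_of_all _ fun t ht x hx => hC x hx t (uIoc_subset_uIcc ht)
  · exact intervalIntegrable_const
  · refine ae_of_all _ fun t _ x hx => ?_
    have h : HasFDerivAt F (fderiv ℝ F (x, t)) (x, t) :=
      ((hF.differentiableOn one_ne_zero).differentiableAt
        (hop.mem_nhds ⟨hsU hx, mem_univ _⟩)).hasFDerivAt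
    exact h.comp x (hasFDerivAt_prodMk_left x t)

/-- Induction on the order of differentiability, by differentiating under the integral. `G` is
quantified inside the induction because the derivative takes values in `E →L[ℝ] G`; having `E` and
`G` in `Type` keeps that space in the same universe. -/
theorem contDiffOn_nat_intervalIntegral (a b : ℝ) {U : Set E} (hU : IsOpen U) (n : ℕ) :
    ∀ {G : Type} [NormedAddCommGroup G] [NormedSpace ℝ G] {F : E × ℝ → G},
      ContDiffOn ℝ n F (U ×ˢ univ) → ContDiffOn ℝ n (fun x => ∫ t in a..b, F (x, t)) U := by
  have hop : IsOpen (U ×ˢ (univ : Set ℝ)) := hU.prod isOpen_univ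
  induction n with
  | zero =>
    intro G _ _ F hF
    simp only [CharP.cast_eq_zero, contDiffOn_zero] at hF ⊢
    exact continuousOn_intervalIntegral hU hF a b
  | succ n ih =>
    intro G _ _ F hF
    push_cast at hF ⊢
    have h1 : ContDiffOn ℝ 1 F (U ×ˢ univ) := hF.of_le (by simp)
    have hD : ∀ x ∈ U, HasFDerivAt _ _ x := fun x hx => hasFDerivAt_intervalIntegral hU h1 a b hx
    rw [contDiffOn_succ_iff_fderiv_of_isOpen hU]
    refine ⟨fun x hx => (hD x hx).differentiableAt.differentiableWithinAt, by simp, ?_⟩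
    refine ContDiffOn.congr (ih (F := fun y =>
      (fderiv ℝ F y).comp (ContinuousLinearMap.inl ℝ E ℝ)) ?_) fun x hx => (hD x hx).fderiv
    exact (((contDiffOn_succ_iff_fderiv_of_isOpen hop).1 hF).2.2).clm_comp contDiffOn_const

theorem contDiffOn_intervalIntegral {U : Set E} (hU : IsOpen U) {F : E × ℝ → G}
    (hF : ContDiffOn ℝ ∞ F (U ×ˢ univ)) (a b : ℝ) :
    ContDiffOn ℝ ∞ (fun x => ∫ t in a..b, F (x, t)) U :=
  contDiffOn_infty.2 fun n => contDiffOn_nat_intervalIntegral a b hU n (contDiffOn_infty.1 hF n)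

end ParametricIntegral

namespace ZonalFlow

/-! ### Calculus on embedded submanifolds -/

section Submanifold

variable {n : ℕ} {S : Set (EuclideanSpace ℝ (Fin n))} {p v : EuclideanSpace ℝ (Fin n)}

theorem mem_tangentSpaceAt_of_curve {γ : ℝ → EuclideanSpace ℝ (Fin n)} {t : ℝ}
    (hγ : HasDerivAt γ v t) (hS : ∀ᶠ s in nhds t, γ s ∈ S) (hp : γ t = p) :
    v ∈ tangentSpaceAt S p := by
  subst hp
  obtain ⟨u, hu, hus⟩ := Filter.eventually_iff_exists_mem.1 hS
  have h := (hγ.hasFDerivAt.hasFDerivWithinAt (s := u)).mapsTo_tangent_cone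
    (show (1 : ℝ) ∈ tangentConeAt ℝ u t by rw [tangentConeAt_of_mem_nhds hu]; trivial)
  have h' : v ∈ tangentConeAt ℝ (γ '' u) (γ t) := by simpa using h
  exact Submodule.subset_span (tangentConeAt_mono (image_subset_iff.2 hus) h')

theorem fderivWithin_eq_of_mem_tangentSpaceAt {G : Type*} [NormedAddCommGroup G] [NormedSpace ℝ G]
    {F : EuclideanSpace ℝ (Fin n) → G} {A : EuclideanSpace ℝ (Fin n) →L[ℝ] G}
    (hA : HasFDerivWithinAt F A S p) (hv : v ∈ tangentSpaceAt S p) :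
    fderivWithin ℝ F S p v = A v :=
  hasFDerivWithinAt_unique_on_tangentSpaceAt hA.differentiableWithinAt.hasFDerivWithinAt hA hv

theorem fderivWithin_smul_of_eqOn {f : EuclideanSpace ℝ (Fin n) → ℝ}
    {X Z : EuclideanSpace ℝ (Fin n) → EuclideanSpace ℝ (Fin n)} (hp : p ∈ S)
    (hf : DifferentiableWithinAt ℝ f S p) (hX : DifferentiableWithinAt ℝ X S p)
    (hZ : ∀ p ∈ S, Z p = f p • X p) (hv : v ∈ tangentSpaceAt S p) :
    fderivWithin ℝ Z S p v = f p • fderivWithin ℝ X S p v + fderivWithin ℝ f S p v • X p := by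
  have h := (hf.hasFDerivWithinAt.smul hX.hasFDerivWithinAt).congr hZ (hZ p hp)
  rw [fderivWithin_eq_of_mem_tangentSpaceAt h hv]
  simp

theorem IsSmoothFunction.differentiableWithinAt {f : EuclideanSpace ℝ (Fin n) → ℝ}
    (hf : IsSmoothFunction S f) (hp : p ∈ S) : DifferentiableWithinAt ℝ f S p :=
  (ContDiffOn.differentiableOn hf (by simp)) p hp

theorem IsVectorField.differentiableWithinAt
    {V : EuclideanSpace ℝ (Fin n) → EuclideanSpace ℝ (Fin n)}
    (hV : IsVectorField S V) (hp : p ∈ S) : DifferentiableWithinAt ℝ V S p :=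
  (hV.1.differentiableOn (by simp)) p hp

theorem inner_starProjection_tangent {w : EuclideanSpace ℝ (Fin n)}
    (hw : w ∈ tangentSpaceAt S p) (u : EuclideanSpace ℝ (Fin n)) :
    ⟪(tangentSpaceAt S p).starProjection u, w⟫ = ⟪u, w⟫ := by
  rw [Submodule.inner_starProjection_left_eq_right, Submodule.starProjection_eq_self_iff.2 hw]

theorem IsKilling.inner_fderivWithin {X : EuclideanSpace ℝ (Fin n) → EuclideanSpace ℝ (Fin n)}
    (hX : IsKilling S X) (hp : p ∈ S) {w : EuclideanSpace ℝ (Fin n)}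
    (hv : v ∈ tangentSpaceAt S p) (hw : w ∈ tangentSpaceAt S p) :
    ⟪fderivWithin ℝ X S p v, w⟫ = -⟪fderivWithin ℝ X S p w, v⟫ := by
  have h := hX.2 p hp v hv w hw
  rwa [cov, cov, inner_starProjection_tangent hw, inner_starProjection_tangent hv] at h

/-- By the Leibniz rule `∇(fX) = f ∇X + df ⊗ X`. The first term has trace zero because `∇X` is skew,
and the second has trace `df(X)`. -/
theorem IsKilling.divergence_smul {f : EuclideanSpace ℝ (Fin n) → ℝ}
    {X Z : EuclideanSpace ℝ (Fin n) → EuclideanSpace ℝ (Fin n)} (hX : IsKilling S X)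
    (hf : IsSmoothFunction S f) (hZ : ∀ p ∈ S, Z p = f p • X p) (hp : p ∈ S) :
    divergence S Z p = fderivWithin ℝ f S p (X p) := by
  set T := tangentSpaceAt S p
  let b := stdOrthonormalBasis ℝ T
  have hXp : X p ∈ T := hX.1.2 p hp
  rw [divergence, LinearMap.trace_eq_sum_inner _ b]
  have key : ∀ i, ⟪b i, T.orthogonalProjectionOnto (fderivWithin ℝ Z S p (b i))⟫ =
      fderivWithin ℝ f S p (⟪(b i : EuclideanSpace ℝ (Fin n)), X p⟫ • (b i)) := by
    intro i
    rw [Submodule.inner_orthogonalProjectionOnto_eq_of_mem_left,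
      fderivWithin_smul_of_eqOn hp (hf.differentiableWithinAt hp) (hX.1.differentiableWithinAt hp)
        hZ (b i).2, inner_add_right, inner_smul_right, inner_smul_right]
    have := hX.inner_fderivWithin hp (b i).2 (b i).2
    rw [real_inner_comm, show ⟪fderivWithin ℝ X S p (b i), (b i : EuclideanSpace ℝ (Fin n))⟫ = 0
      by linarith]
    simp [mul_comm]
  have hsum : ∑ i, ⟪(b i : EuclideanSpace ℝ (Fin n)), X p⟫ • (b i : EuclideanSpace ℝ (Fin n))
      = X p := by
    have := congrArg (Subtype.val) (b.sum_repr' ⟨X p, hXp⟩)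
    simpa using this
  calc _ = ∑ i, fderivWithin ℝ f S p (⟪(b i : EuclideanSpace ℝ (Fin n)), X p⟫ • (b i)) :=
        Finset.sum_congr rfl fun i _ => key i
    _ = _ := by rw [← map_sum, hsum]

end Submanifold

/-! ### The ellipsoid, its tangent planes and the retraction of `ℝ³ ∖ {0}` onto it -/

section Ellipsoid

local notation "E3" => EuclideanSpace ℝ (Fin 3)

theorem inner_three (u v : E3) : ⟪u, v⟫ = u 0 * v 0 + u 1 * v 1 + u 2 * v 2 := by
  simp [PiLp.inner_apply, Fin.sum_univ_three, mul_comm]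

theorem ext_three {u v : E3} (h0 : u 0 = v 0) (h1 : u 1 = v 1) (h2 : u 2 = v 2) : u = v := by
  ext i; fin_cases i <;> assumption

theorem hasDerivAt_three {f : ℝ → E3} {f' : E3} {t : ℝ}
    (h0 : HasDerivAt (fun t => f t 0) (f' 0) t) (h1 : HasDerivAt (fun t => f t 1) (f' 1) t)
    (h2 : HasDerivAt (fun t => f t 2) (f' 2) t) : HasDerivAt f f' t := by
  have h : HasDerivAt (fun t => (fun i => f t i : Fin 3 → ℝ)) (fun i => f' i) t :=
    hasDerivAt_pi.2 fun i => by fin_cases i <;> assumption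
  exact (PiLp.continuousLinearEquiv 2 ℝ (fun _ : Fin 3 => ℝ)).symm.toContinuousLinearMap
    |>.hasFDerivAt.comp_hasDerivAt t h

theorem contDiff_coord (i : Fin 3) : ContDiff ℝ ∞ fun p : E3 => p i :=
  (EuclideanSpace.proj (𝕜 := ℝ) i).contDiff

variable {a : ℝ} {p v : E3}

/-- The quadratic form whose unit level set is the ellipsoid. -/
def quad (a : ℝ) (p : E3) : ℝ := (p 0 ^ 2 + p 1 ^ 2) / a ^ 2 + p 2 ^ 2

theorem quad_eq_one_iff (ha : 0 < a) : quad a p = 1 ↔ p ∈ ellipsoid a := by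
  simp only [quad, ellipsoid, mem_ofPred_eq]
  have := ha.ne'
  field_simp
  constructor <;> intro h <;> linarith

theorem quad_nonneg (p : E3) : 0 ≤ quad a p := by
  unfold quad; positivity

theorem quad_pos (ha : 0 < a) (hp : p ≠ 0) : 0 < quad a p := by
  refine lt_of_le_of_ne (quad_nonneg p) fun h => hp ?_
  have h2 : p 2 ^ 2 = 0 := by
    have : 0 ≤ (p 0 ^ 2 + p 1 ^ 2) / a ^ 2 := by positivity
    simp only [quad] at h
    nlinarith [sq_nonneg (p 2)]
  have h01 : p 0 ^ 2 + p 1 ^ 2 = 0 := by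
    simp only [quad, h2, add_zero] at h
    have := ha.ne'
    field_simp at h
    linarith
  have h0 : p 0 = 0 := by nlinarith [sq_nonneg (p 1), sq_nonneg (p 0)]
  have h1 : p 1 = 0 := by nlinarith [sq_nonneg (p 1), sq_nonneg (p 0)]
  exact ext_three h0 h1 (by simpa using h2)

theorem quad_smul (c : ℝ) (p : E3) : quad a (c • p) = c ^ 2 * quad a p := by
  simp [quad]; ring

theorem contDiff_quad : ContDiff ℝ ∞ (quad a) := by
  have h := contDiff_coord
  unfold quad
  exact ((((h 0).pow 2).add ((h 1).pow 2)).div_const _).add ((h 2).pow 2)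

theorem ne_zero_of_mem_ellipsoid (ha : 0 < a) (hp : p ∈ ellipsoid a) : p ≠ 0 := by
  rintro rfl
  have := (quad_eq_one_iff ha).2 hp
  simp [quad] at this

/-- The central projection of `ℝ³ ∖ {0}` to the ellipsoid. -/
def centralProj (a : ℝ) (p : E3) : E3 := (√(quad a p))⁻¹ • p

theorem centralProj_mem (ha : 0 < a) (hp : p ≠ 0) : centralProj a p ∈ ellipsoid a := by
  have h := quad_pos ha hp
  rw [← quad_eq_one_iff ha, centralProj, quad_smul, inv_pow, Real.sq_sqrt h.le]
  field_simp

theorem centralProj_of_mem (ha : 0 < a) (hp : p ∈ ellipsoid a) : centralProj a p = p := by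
  simp [centralProj, (quad_eq_one_iff ha).2 hp]

theorem contDiffOn_centralProj (ha : 0 < a) : ContDiffOn ℝ ∞ (centralProj a) {0}ᶜ := by
  have h : ContDiffOn ℝ ∞ (fun p => √(quad a p)) {0}ᶜ :=
    contDiff_quad.contDiffOn.sqrt fun p hp => (quad_pos ha hp).ne'
  exact (h.inv fun p hp => (Real.sqrt_pos.2 (quad_pos ha hp)).ne').smul contDiffOn_id

/-- Together with its converse below, this turns smoothness along the ellipsoid into smoothness on
the open set `{0}ᶜ`, where `fderiv` can be iterated. -/
theorem contDiffOn_comp_centralProj {G : Type*} [NormedAddCommGroup G] [NormedSpace ℝ G]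
    (ha : 0 < a) {F : E3 → G} (hF : ContDiffOn ℝ ∞ F (ellipsoid a)) :
    ContDiffOn ℝ ∞ (fun p => F (centralProj a p)) {0}ᶜ :=
  hF.comp (contDiffOn_centralProj ha) fun _ hp => centralProj_mem ha hp

theorem contDiffOn_of_contDiffOn_comp_centralProj {G : Type*} [NormedAddCommGroup G]
    [NormedSpace ℝ G] (ha : 0 < a) {F : E3 → G}
    (hF : ContDiffOn ℝ ∞ (fun p => F (centralProj a p)) {0}ᶜ) : ContDiffOn ℝ ∞ F (ellipsoid a) :=
  (hF.mono fun _ hp => ne_zero_of_mem_ellipsoid ha hp).congr fun p hp => by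
    rw [centralProj_of_mem ha hp]

theorem mem_tangentSpaceAt_ellipsoid_iff (ha : 0 < a) (hp : p ∈ ellipsoid a) :
    v ∈ tangentSpaceAt (ellipsoid a) p ↔ p 0 * v 0 + p 1 * v 1 + a ^ 2 * (p 2 * v 2) = 0 := by
  constructor
  -- The defining function is constant on the ellipsoid, so its differential vanishes on tangent
  -- vectors.
  · intro hv
    have hD : HasFDerivAt (fun q : E3 => q 0 ^ 2 + q 1 ^ 2 + a ^ 2 * q 2 ^ 2)
        (((2 * p 0) • EuclideanSpace.proj (𝕜 := ℝ) 0 + (2 * p 1) • EuclideanSpace.proj (𝕜 := ℝ) 1)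
          + a ^ 2 • ((2 * p 2) • EuclideanSpace.proj (𝕜 := ℝ) 2) : E3 →L[ℝ] ℝ) p := by
      have h (i : Fin 3) : HasFDerivAt (fun q : E3 => q i ^ 2)
          ((2 * p i) • EuclideanSpace.proj (𝕜 := ℝ) i : E3 →L[ℝ] ℝ) p := by
        simpa using (EuclideanSpace.proj (𝕜 := ℝ) i : E3 →L[ℝ] ℝ).hasFDerivAt.pow 2 (x := p)
      exact ((h 0).add (h 1)).add ((h 2).const_mul (a ^ 2))
    have hc : HasFDerivWithinAt (fun q : E3 => q 0 ^ 2 + q 1 ^ 2 + a ^ 2 * q 2 ^ 2)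
        (0 : E3 →L[ℝ] ℝ) (ellipsoid a) p := by
      refine (hasFDerivWithinAt_const (a ^ 2) p (ellipsoid a)).congr (fun q hq => ?_) ?_
      · simp only [ellipsoid, mem_ofPred_eq] at hq; linarith
      · simp only [ellipsoid, mem_ofPred_eq] at hp; linarith
    have := hasFDerivWithinAt_unique_on_tangentSpaceAt hD.hasFDerivWithinAt hc hv
    simp at this
    linarith
  · intro hv
    -- Tangency removes the term linear in `t`, so normalizing the line `p + t • v` does not change
    -- its velocity at `0`; the projected line is a curve on the ellipsoid with velocity `v`.
    have hq : ∀ t : ℝ, quad a (p + t • v) = 1 + quad a v * t ^ 2 := by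
      intro t
      rw [← (quad_eq_one_iff ha).2 hp]
      have := ha.ne'
      simp only [quad, PiLp.add_apply, PiLp.smul_apply, smul_eq_mul]
      field_simp
      linear_combination 2 * t * hv
    have hpos : ∀ t : ℝ, 0 < quad a (p + t • v) := fun t => by
      rw [hq]; have := quad_nonneg (a := a) v; positivity
    have hd : HasDerivAt (fun t : ℝ => quad a (p + t • v)) 0 0 := by
      simp only [hq]
      simpa using ((hasDerivAt_id (0 : ℝ)).pow 2).const_mul (quad a v) |>.const_add 1
    have hs : HasDerivAt (fun t : ℝ => (√(quad a (p + t • v)))⁻¹) 0 0 := by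
      simpa using (hd.sqrt (hpos 0).ne').fun_inv (Real.sqrt_pos.2 (hpos 0)).ne'
    have hl : HasDerivAt (fun t : ℝ => p + t • v) v 0 := by
      simpa using ((hasDerivAt_id (0 : ℝ)).smul_const v).const_add p
    have hγ : HasDerivAt (fun t : ℝ => centralProj a (p + t • v)) v 0 :=
      (hs.fun_smul hl).congr_deriv (by simp [(quad_eq_one_iff ha).2 hp])
    refine mem_tangentSpaceAt_of_curve hγ (Filter.Eventually.of_forall fun t => ?_)
      (by simp [centralProj_of_mem ha hp])
    refine centralProj_mem ha fun h => (hpos t).ne' ?_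
    simp [h, quad]

/-! ### Rotations about the axis -/

/-- `∂_θ` as a linear map. -/
def dThetaCLM : E3 →L[ℝ] E3 :=
  LinearMap.toContinuousLinearMap
    { toFun := dTheta
      map_add' := fun u v => ext_three (by simp [dTheta]; ring) (by simp [dTheta])
        (by simp [dTheta])
      map_smul' := fun c u => ext_three (by simp [dTheta]) (by simp [dTheta]) (by simp [dTheta]) }

theorem dThetaCLM_apply (p : E3) : dThetaCLM p = dTheta p := rfl

@[simp] theorem dTheta_zero_coord (p : E3) : dTheta p 0 = -p 1 := rfl
@[simp] theorem dTheta_one_coord (p : E3) : dTheta p 1 = p 0 := rfl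
@[simp] theorem dTheta_two_coord (p : E3) : dTheta p 2 = 0 := rfl

theorem hasFDerivAt_dTheta (p : E3) : HasFDerivAt dTheta dThetaCLM p := dThetaCLM.hasFDerivAt

theorem isVectorField_dTheta (ha : 0 < a) : IsVectorField (ellipsoid a) dTheta := by
  refine ⟨dThetaCLM.contDiff.contDiffOn, fun p hp => ?_⟩
  rw [mem_tangentSpaceAt_ellipsoid_iff ha hp]
  simp; ring

theorem isKilling_dTheta (ha : 0 < a) : IsKilling (ellipsoid a) dTheta := by
  refine ⟨isVectorField_dTheta ha, fun p hp v hv w hw => ?_⟩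
  have h := (hasFDerivAt_dTheta p).hasFDerivWithinAt (s := ellipsoid a)
  rw [cov, cov, inner_starProjection_tangent hw, inner_starProjection_tangent hv,
    fderivWithin_eq_of_mem_tangentSpaceAt h hv, fderivWithin_eq_of_mem_tangentSpaceAt h hw]
  simp [inner_three, dThetaCLM_apply]
  ring

/-- The rotation about the axis by an element of the circle. -/
def axisRotation (s : Circle) (p : E3) : E3 :=
  !₂[(s : ℂ).re * p 0 - (s : ℂ).im * p 1, (s : ℂ).im * p 0 + (s : ℂ).re * p 1, p 2]

theorem circle_re_sq_add_im_sq (s : Circle) : (s : ℂ).re ^ 2 + (s : ℂ).im ^ 2 = 1 := by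
  have := Circle.normSq_coe s
  rw [Complex.normSq_apply] at this
  linarith

theorem isCircleAction_axisRotation : IsCircleAction (ellipsoid a) axisRotation where
  mapsTo s p hp := by
    simp only [ellipsoid, mem_ofPred_eq, axisRotation, Matrix.cons_val] at hp ⊢
    linear_combination hp + (p 0 ^ 2 + p 1 ^ 2) * circle_re_sq_add_im_sq s
  one p _ := ext_three (by simp [axisRotation]) (by simp [axisRotation]) (by simp [axisRotation])
  mul s t p _ := ext_three (by simp [axisRotation]; ring) (by simp [axisRotation]; ring)
    (by simp [axisRotation])
  smooth := by
    apply ContDiff.contDiffOn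
    have hc : ContDiff ℝ ∞ fun x : ℝ × E3 => Real.cos x.1 := Real.contDiff_cos.comp contDiff_fst
    have hs : ContDiff ℝ ∞ fun x : ℝ × E3 => Real.sin x.1 := Real.contDiff_sin.comp contDiff_fst
    have h (i : Fin 3) : ContDiff ℝ ∞ fun x : ℝ × E3 => x.2 i := (contDiff_coord i).comp contDiff_snd
    rw [contDiff_euclidean]
    intro i
    fin_cases i
    · simpa [axisRotation, Circle.coe_exp, Complex.exp_ofReal_mul_I_re, Complex.exp_ofReal_mul_I_im]
        using (hc.mul (h 0)).sub (hs.mul (h 1))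
    · simpa [axisRotation, Circle.coe_exp, Complex.exp_ofReal_mul_I_re, Complex.exp_ofReal_mul_I_im]
        using (hs.mul (h 0)).add (hc.mul (h 1))
    · simpa [axisRotation] using h 2

theorem isInducedByCircleAction_dTheta : IsInducedByCircleAction (ellipsoid a) dTheta := by
  refine ⟨axisRotation, isCircleAction_axisRotation, fun p _ => ?_⟩
  have hc := Real.hasDerivAt_cos 0
  have hs := Real.hasDerivAt_sin 0
  apply hasDerivAt_three
  · simpa [axisRotation, Circle.coe_exp, Complex.exp_ofReal_mul_I_re, Complex.exp_ofReal_mul_I_im]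
      using (hc.mul_const (p 0)).fun_sub (hs.mul_const (p 1))
  · simpa [axisRotation, Circle.coe_exp, Complex.exp_ofReal_mul_I_re, Complex.exp_ofReal_mul_I_im]
      using (hs.mul_const (p 0)).fun_add (hc.mul_const (p 1))
  · simpa [axisRotation] using hasDerivAt_const (0 : ℝ) (p 2)

end Ellipsoid

/-! ### Geographic coordinates and the Killing fields of the ellipsoid -/

section Killing

local notation "E3" => EuclideanSpace ℝ (Fin 3)

/-- The point of the ellipsoid with latitude parameter `τ` and longitude `θ`. -/
def geo (a τ θ : ℝ) : E3 :=
  !₂[a * (Real.cos τ * Real.cos θ), a * (Real.cos τ * Real.sin θ), Real.sin τ]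

/-- The velocity of the meridians. -/
def geoTau (a τ θ : ℝ) : E3 :=
  !₂[-a * (Real.sin τ * Real.cos θ), -a * (Real.sin τ * Real.sin θ), Real.cos τ]

/-- The mixed second derivative of `geo`. -/
def geoTauTheta (a τ θ : ℝ) : E3 :=
  !₂[a * (Real.sin τ * Real.sin θ), -a * (Real.sin τ * Real.cos θ), 0]

/-- The squared speed of the meridians. -/
def meridianEnergy (a τ : ℝ) : ℝ := a ^ 2 * Real.sin τ ^ 2 + Real.cos τ ^ 2

variable {a : ℝ}

@[simp] theorem geo_zero_coord (a τ θ : ℝ) : geo a τ θ 0 = a * (Real.cos τ * Real.cos θ) := rfl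
@[simp] theorem geo_one_coord (a τ θ : ℝ) : geo a τ θ 1 = a * (Real.cos τ * Real.sin θ) := rfl
@[simp] theorem geo_two_coord (a τ θ : ℝ) : geo a τ θ 2 = Real.sin τ := rfl
@[simp] theorem geoTau_zero_coord (a τ θ : ℝ) :
    geoTau a τ θ 0 = -a * (Real.sin τ * Real.cos θ) := rfl
@[simp] theorem geoTau_one_coord (a τ θ : ℝ) :
    geoTau a τ θ 1 = -a * (Real.sin τ * Real.sin θ) := rfl
@[simp] theorem geoTau_two_coord (a τ θ : ℝ) : geoTau a τ θ 2 = Real.cos τ := rfl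
@[simp] theorem geoTauTheta_zero_coord (a τ θ : ℝ) :
    geoTauTheta a τ θ 0 = a * (Real.sin τ * Real.sin θ) := rfl
@[simp] theorem geoTauTheta_one_coord (a τ θ : ℝ) :
    geoTauTheta a τ θ 1 = -a * (Real.sin τ * Real.cos θ) := rfl
@[simp] theorem geoTauTheta_two_coord (a τ θ : ℝ) : geoTauTheta a τ θ 2 = 0 := rfl

theorem meridianEnergy_pos (ha : 0 < a) (τ : ℝ) : 0 < meridianEnergy a τ := by
  have h := Real.sin_sq_add_cos_sq τ
  unfold meridianEnergy
  rcases (sq_nonneg (Real.sin τ)).eq_or_lt with h0 | h0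
  · rw [← h0] at h ⊢; linarith
  · have := sq_nonneg (Real.cos τ); positivity

theorem geo_mem (a τ θ : ℝ) : geo a τ θ ∈ ellipsoid a := by
  simp only [ellipsoid, mem_ofPred_eq, geo_zero_coord, geo_one_coord, geo_two_coord]
  linear_combination a ^ 2 * Real.cos τ ^ 2 * Real.sin_sq_add_cos_sq θ
    + a ^ 2 * Real.sin_sq_add_cos_sq τ

theorem sq_coord_two_le (ha : 0 < a) {p : E3} (hp : p ∈ ellipsoid a) : p 2 ^ 2 ≤ 1 := by
  simp only [ellipsoid, mem_ofPred_eq] at hp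
  have : 0 ≤ a ^ 2 * (1 - p 2 ^ 2) := hp ▸ by positivity
  have := nonneg_of_mul_nonneg_right this (by positivity)
  linarith

theorem sin_arcsin_coord_two (ha : 0 < a) {p : E3} (hp : p ∈ ellipsoid a) :
    Real.sin (Real.arcsin (p 2)) = p 2 := by
  have h := abs_le_one_iff_mul_self_le_one.2 (by nlinarith [sq_coord_two_le ha hp] : p 2 * p 2 ≤ 1)
  exact Real.sin_arcsin (abs_le.1 h).1 (abs_le.1 h).2

theorem exists_eq_geo (ha : 0 < a) {p : E3} (hp : p ∈ ellipsoid a) :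
    ∃ θ, p = geo a (Real.arcsin (p 2)) θ := by
  set τ := Real.arcsin (p 2) with hτ
  have hs : Real.sin τ = p 2 := sin_arcsin_coord_two ha hp
  have hc : 0 ≤ Real.cos τ := Real.cos_arcsin_nonneg _
  have hn : p 0 ^ 2 + p 1 ^ 2 = (a * Real.cos τ) ^ 2 := by
    simp only [ellipsoid, mem_ofPred_eq] at hp
    rw [hp, ← hs]; linear_combination -a ^ 2 * Real.sin_sq_add_cos_sq τ
  let w : ℂ := ⟨p 0, p 1⟩
  have hw : ‖w‖ = a * Real.cos τ := by
    rw [← abs_of_nonneg (norm_nonneg w), ← abs_of_nonneg (mul_nonneg ha.le hc), ← sq_eq_sq_iff_abs_eq_abs,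
      ← hn, ← Complex.normSq_eq_norm_sq, Complex.normSq_apply]
    ring
  refine ⟨Complex.arg w, ext_three ?_ ?_ hs.symm⟩
  · rw [geo_zero_coord, ← mul_assoc, ← hw, Complex.norm_mul_cos_arg]
  · rw [geo_one_coord, ← mul_assoc, ← hw, Complex.norm_mul_sin_arg]

theorem hasDerivAt_geo_tau (a τ θ : ℝ) : HasDerivAt (fun τ => geo a τ θ) (geoTau a τ θ) τ := by
  apply hasDerivAt_three
  · exact (((Real.hasDerivAt_cos τ).mul_const _).const_mul a).congr_deriv (by simp)
  · exact (((Real.hasDerivAt_cos τ).mul_const _).const_mul a).congr_deriv (by simp)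
  · exact Real.hasDerivAt_sin τ

theorem hasDerivAt_geo_theta (a τ θ : ℝ) :
    HasDerivAt (fun θ => geo a τ θ) (dTheta (geo a τ θ)) θ := by
  apply hasDerivAt_three
  · exact (((Real.hasDerivAt_cos θ).const_mul _).const_mul a).congr_deriv (by simp)
  · exact ((Real.hasDerivAt_sin θ).const_mul _).const_mul a
  · exact hasDerivAt_const _ _

theorem hasDerivAt_geoTau_tau (a τ θ : ℝ) :
    HasDerivAt (fun τ => geoTau a τ θ) (-geo a τ θ) τ := by
  apply hasDerivAt_three
  · exact (((Real.hasDerivAt_sin τ).mul_const _).const_mul (-a)).congr_deriv (by simp)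
  · exact (((Real.hasDerivAt_sin τ).mul_const _).const_mul (-a)).congr_deriv (by simp)
  · exact Real.hasDerivAt_cos τ

theorem hasDerivAt_geoTau_theta (a τ θ : ℝ) :
    HasDerivAt (fun θ => geoTau a τ θ) (geoTauTheta a τ θ) θ := by
  apply hasDerivAt_three
  · exact (((Real.hasDerivAt_cos θ).const_mul _).const_mul (-a)).congr_deriv (by simp)
  · exact ((Real.hasDerivAt_sin θ).const_mul _).const_mul (-a)
  · exact hasDerivAt_const _ _

theorem hasDerivAt_dTheta_geo_tau (a τ θ : ℝ) :
    HasDerivAt (fun τ => dTheta (geo a τ θ)) (geoTauTheta a τ θ) τ := by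
  refine ((hasFDerivAt_dTheta _).comp_hasDerivAt τ (hasDerivAt_geo_tau a τ θ)).congr_deriv ?_
  exact ext_three (by simp [dThetaCLM_apply]) (by simp [dThetaCLM_apply])
    (by simp [dThetaCLM_apply])

theorem hasDerivAt_dTheta_geo_theta (a τ θ : ℝ) :
    HasDerivAt (fun θ => dTheta (geo a τ θ)) (dTheta (dTheta (geo a τ θ))) θ :=
  (hasFDerivAt_dTheta _).comp_hasDerivAt θ (hasDerivAt_geo_theta a τ θ)

theorem geoTau_mem_tangentSpaceAt (a τ θ : ℝ) :
    geoTau a τ θ ∈ tangentSpaceAt (ellipsoid a) (geo a τ θ) :=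
  mem_tangentSpaceAt_of_curve (hasDerivAt_geo_tau a τ θ)
    (Filter.Eventually.of_forall fun τ => geo_mem a τ θ) rfl

theorem dTheta_geo_mem_tangentSpaceAt (a τ θ : ℝ) :
    dTheta (geo a τ θ) ∈ tangentSpaceAt (ellipsoid a) (geo a τ θ) :=
  mem_tangentSpaceAt_of_curve (hasDerivAt_geo_theta a τ θ)
    (Filter.Eventually.of_forall fun θ => geo_mem a τ θ) rfl

theorem hasDerivAt_comp_geo_tau {G : Type*} [NormedAddCommGroup G] [NormedSpace ℝ G] {F : E3 → G}
    {τ θ : ℝ} (hF : DifferentiableWithinAt ℝ F (ellipsoid a) (geo a τ θ)) :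
    HasDerivAt (fun τ => F (geo a τ θ))
      (fderivWithin ℝ F (ellipsoid a) (geo a τ θ) (geoTau a τ θ)) τ :=
  hF.hasFDerivWithinAt.comp_hasDerivAt τ (hasDerivAt_geo_tau a τ θ)
    (Filter.Eventually.of_forall fun τ => geo_mem a τ θ)

theorem hasDerivAt_comp_geo_theta {G : Type*} [NormedAddCommGroup G] [NormedSpace ℝ G]
    {F : E3 → G} {τ θ : ℝ} (hF : DifferentiableWithinAt ℝ F (ellipsoid a) (geo a τ θ)) :
    HasDerivAt (fun θ => F (geo a τ θ))
      (fderivWithin ℝ F (ellipsoid a) (geo a τ θ) (dTheta (geo a τ θ))) θ :=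
  hF.hasFDerivWithinAt.comp_hasDerivAt θ (hasDerivAt_geo_theta a τ θ)
    (Filter.Eventually.of_forall fun θ => geo_mem a τ θ)

theorem hasDerivAt_meridianEnergy (a τ : ℝ) :
    HasDerivAt (meridianEnergy a) (2 * ((a ^ 2 - 1) * (Real.sin τ * Real.cos τ))) τ := by
  refine ((((Real.hasDerivAt_sin τ).pow 2).const_mul (a ^ 2)).add
    ((Real.hasDerivAt_cos τ).pow 2)).congr_deriv ?_
  simp; ring

/-! ### Components of tangent vectors in geographic coordinates. -/

section TangentVector

variable {τ θ : ℝ} {w : E3}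

theorem tangent_geo_eq (ha : 0 < a) (hw : w ∈ tangentSpaceAt (ellipsoid a) (geo a τ θ)) :
    Real.cos τ * (Real.cos θ * w 0 + Real.sin θ * w 1) + a * (Real.sin τ * w 2) = 0 := by
  rw [mem_tangentSpaceAt_ellipsoid_iff ha (geo_mem a τ θ)] at hw
  simp only [geo_zero_coord, geo_one_coord, geo_two_coord] at hw
  apply mul_left_cancel₀ ha.ne'
  linear_combination hw

/-- The radial and vertical parts of a tangent vector form a planar vector orthogonal to the normal
of the meridian, hence a multiple of the meridian velocity. The factor `meridianEnergy` is the
squared length of that velocity, kept on the left to avoid division. -/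
theorem energy_mul_radial (ha : 0 < a) (hw : w ∈ tangentSpaceAt (ellipsoid a) (geo a τ θ)) :
    meridianEnergy a τ * (Real.cos θ * w 0 + Real.sin θ * w 1) =
      -a * Real.sin τ * ⟪w, geoTau a τ θ⟫ := by
  simp only [inner_three, geoTau_zero_coord, geoTau_one_coord, geoTau_two_coord, meridianEnergy]
  linear_combination Real.cos τ * tangent_geo_eq ha hw

theorem energy_mul_vertical (ha : 0 < a) (hw : w ∈ tangentSpaceAt (ellipsoid a) (geo a τ θ)) :
    meridianEnergy a τ * w 2 = Real.cos τ * ⟪w, geoTau a τ θ⟫ := by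
  simp only [inner_three, geoTau_zero_coord, geoTau_one_coord, geoTau_two_coord, meridianEnergy]
  linear_combination a * Real.sin τ * tangent_geo_eq ha hw

theorem energy_mul_inner_geo (ha : 0 < a) (hw : w ∈ tangentSpaceAt (ellipsoid a) (geo a τ θ)) :
    meridianEnergy a τ * ⟪w, geo a τ θ⟫ =
      -((a ^ 2 - 1) * (Real.sin τ * Real.cos τ)) * ⟪w, geoTau a τ θ⟫ := by
  have h : ⟪w, geo a τ θ⟫ =
      a * Real.cos τ * (Real.cos θ * w 0 + Real.sin θ * w 1) + Real.sin τ * w 2 := by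
    simp only [inner_three, geo_zero_coord, geo_one_coord, geo_two_coord]; ring
  rw [h]
  linear_combination a * Real.cos τ * energy_mul_radial ha hw + Real.sin τ * energy_mul_vertical ha hw

theorem energy_mul_inner_dTheta_dTheta (ha : 0 < a)
    (hw : w ∈ tangentSpaceAt (ellipsoid a) (geo a τ θ)) :
    meridianEnergy a τ * ⟪w, dTheta (dTheta (geo a τ θ))⟫ =
      a ^ 2 * (Real.sin τ * Real.cos τ) * ⟪w, geoTau a τ θ⟫ := by
  have h : ⟪w, dTheta (dTheta (geo a τ θ))⟫ =
      -(a * Real.cos τ * (Real.cos θ * w 0 + Real.sin θ * w 1)) := by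
    simp [inner_three]; ring
  rw [h]
  linear_combination -a * Real.cos τ * energy_mul_radial ha hw

theorem cos_mul_inner_geoTauTheta :
    Real.cos τ * ⟪w, geoTauTheta a τ θ⟫ = -Real.sin τ * ⟪w, dTheta (geo a τ θ)⟫ := by
  simp [inner_three]; ring

theorem eq_smul_dTheta_of_inner (ha : 0 < a) (hc : Real.cos τ ≠ 0)
    (hw : w ∈ tangentSpaceAt (ellipsoid a) (geo a τ θ)) (h0 : ⟪w, geoTau a τ θ⟫ = 0) {c : ℝ}
    (h1 : ⟪w, dTheta (geo a τ θ)⟫ = c * (a * Real.cos τ) ^ 2) : w = c • dTheta (geo a τ θ) := by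
  have hE := (meridianEnergy_pos ha τ).ne'
  have hr : Real.cos θ * w 0 + Real.sin θ * w 1 = 0 := by
    have := energy_mul_radial ha hw
    rw [h0, mul_zero] at this
    exact (mul_eq_zero.1 this).resolve_left hE
  have hv : w 2 = 0 := by
    have := energy_mul_vertical ha hw
    rw [h0, mul_zero] at this
    exact (mul_eq_zero.1 this).resolve_left hE
  have ht : Real.cos θ * w 1 - Real.sin θ * w 0 = c * (a * Real.cos τ) := by
    apply mul_left_cancel₀ (mul_ne_zero ha.ne' hc)
    simp [inner_three] at h1
    linear_combination h1
  have hcs := Real.sin_sq_add_cos_sq θ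
  refine ext_three ?_ ?_ ?_
  · simp
    linear_combination Real.cos θ * hr - Real.sin θ * ht - w 0 * hcs
  · simp
    linear_combination Real.sin θ * hr + Real.cos θ * ht - w 1 * hcs
  · simpa using hv

end TangentVector

/-! ### Integration of the Killing equations. -/

variable {X : E3 → E3}

/-- Conservation of the component along the unit tangent of a meridian. The Killing equation removes
the derivative of `X`, and the acceleration `-geo` of the meridian contributes exactly the
logarithmic derivative of its speed. -/
theorem IsKilling.inner_geoTau_eq (ha : 0 < a) (hX : IsKilling (ellipsoid a) X) (τ θ : ℝ) :
    ⟪X (geo a τ θ), geoTau a τ θ⟫ = √(meridianEnergy a τ) *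
      (-(X !₂[0, 0, 1] 0) * Real.cos θ - X !₂[0, 0, 1] 1 * Real.sin θ) := by
  have hd : ∀ τ, HasDerivAt (fun τ => ⟪X (geo a τ θ), geoTau a τ θ⟫ / √(meridianEnergy a τ)) 0 τ := by
    intro τ
    have hp := geo_mem a τ θ
    have hE := meridianEnergy_pos ha τ
    have hsE := Real.sqrt_pos.2 hE
    have h1 := (hasDerivAt_comp_geo_tau (hX.1.differentiableWithinAt hp)).inner ℝ
      (hasDerivAt_geoTau_tau a τ θ)
    have h2 := (hasDerivAt_meridianEnergy a τ).sqrt hE.ne'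
    refine (h1.div h2 hsE.ne').congr_deriv ?_
    have hT := geoTau_mem_tangentSpaceAt a τ θ
    have hK := hX.inner_fderivWithin hp hT hT
    have hK0 : ⟪fderivWithin ℝ X (ellipsoid a) (geo a τ θ) (geoTau a τ θ), geoTau a τ θ⟫ = 0 := by
      linarith
    have hg := energy_mul_inner_geo ha (hX.1.2 _ hp)
    have hsq := Real.sq_sqrt hE.le
    rw [hK0, inner_neg_right, add_zero]
    field_simp
    rw [hsq]
    linear_combination -hg
  -- All meridians meet the north pole at `τ = π / 2`, with velocity `(-a cos θ, -a sin θ, 0)` of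
  -- length `a`.
  have hconst := is_const_of_deriv_eq_zero (fun τ => (hd τ).differentiableAt)
    (fun τ => (hd τ).deriv) τ (Real.pi / 2)
  have hpole : geo a (Real.pi / 2) θ = !₂[0, 0, 1] :=
    ext_three (by simp) (by simp) (by simp)
  have hsE := (Real.sqrt_pos.2 (meridianEnergy_pos ha τ)).ne'
  have hEp : √(meridianEnergy a (Real.pi / 2)) = a := by
    simp [meridianEnergy, Real.sqrt_sq ha.le]
  simp only [hpole, hEp] at hconst
  rw [div_eq_iff hsE] at hconst
  rw [hconst, mul_comm]
  congr 1
  have := ha.ne'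
  simp [inner_three]
  field_simp
  ring

/-- The Killing equation for the pair `(∂_θ, ∂_θ)` expresses the `θ`-derivative of `⟪X, ∂_θ⟫`
through the meridional component, which is known; integrate from longitude `0`. -/
theorem IsKilling.inner_dTheta_sub_eq (ha : 0 < a) (hX : IsKilling (ellipsoid a) X) (τ θ : ℝ) :
    ⟪X (geo a τ θ), dTheta (geo a τ θ)⟫ = ⟪X (geo a τ 0), dTheta (geo a τ 0)⟫ +
      a ^ 2 * (Real.sin τ * Real.cos τ) / √(meridianEnergy a τ) *
        (-(X !₂[0, 0, 1] 0) * Real.sin θ + X !₂[0, 0, 1] 1 * (Real.cos θ - 1)) := by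
  have hd : ∀ θ, HasDerivAt (fun θ => ⟪X (geo a τ θ), dTheta (geo a τ θ)⟫ -
      a ^ 2 * (Real.sin τ * Real.cos τ) / √(meridianEnergy a τ) *
        (-(X !₂[0, 0, 1] 0) * Real.sin θ + X !₂[0, 0, 1] 1 * (Real.cos θ - 1))) 0 θ := by
    intro θ
    have hp := geo_mem a τ θ
    have hE := meridianEnergy_pos ha τ
    have hsE := Real.sqrt_pos.2 hE
    have h1 := (hasDerivAt_comp_geo_theta (hX.1.differentiableWithinAt hp)).inner ℝ
      (hasDerivAt_dTheta_geo_theta a τ θ)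
    have h2 := (((Real.hasDerivAt_sin θ).const_mul (-(X !₂[0, 0, 1] 0))).add
      (((Real.hasDerivAt_cos θ).sub_const 1).const_mul (X !₂[0, 0, 1] 1))).const_mul
      (a ^ 2 * (Real.sin τ * Real.cos τ) / √(meridianEnergy a τ))
    refine (h1.sub h2).congr_deriv ?_
    have hT := dTheta_geo_mem_tangentSpaceAt a τ θ
    have hK := hX.inner_fderivWithin hp hT hT
    have hK0 : ⟪fderivWithin ℝ X (ellipsoid a) (geo a τ θ) (dTheta (geo a τ θ)),
        dTheta (geo a τ θ)⟫ = 0 := by linarith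
    have hg := energy_mul_inner_dTheta_dTheta ha (hX.1.2 _ hp)
    rw [hX.inner_geoTau_eq ha] at hg
    have hsq := Real.sq_sqrt hE.le
    rw [hK0, add_zero, sub_eq_zero]
    apply mul_left_cancel₀ hE.ne'
    rw [hg]
    field_simp
    rw [hsq]
    ring
  have hconst := is_const_of_deriv_eq_zero (fun θ => (hd θ).differentiableAt)
    (fun θ => (hd θ).deriv) θ 0
  simp only [Real.sin_zero, Real.cos_zero, sub_self, mul_zero, add_zero, sub_zero] at hconst
  linarith

/-- The Killing equation for the mixed pair: the term `⟪∇_τ X, ∂_θ⟫` is traded for `-⟪∇_θ X,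
geoTau⟫`, which follows from differentiating the known meridional component in `θ`. -/
theorem IsKilling.hasDerivAt_inner_dTheta (ha : 0 < a) (hX : IsKilling (ellipsoid a) X)
    (τ θ : ℝ) :
    HasDerivAt (fun τ => ⟪X (geo a τ θ), dTheta (geo a τ θ)⟫)
      (2 * ⟪X (geo a τ θ), geoTauTheta a τ θ⟫ - √(meridianEnergy a τ) *
      (X !₂[0, 0, 1] 0 * Real.sin θ - X !₂[0, 0, 1] 1 * Real.cos θ)) τ := by
  have hp := geo_mem a τ θ
  have hXd := hX.1.differentiableWithinAt hp
  have h1 := (hasDerivAt_comp_geo_theta hXd).inner ℝ (hasDerivAt_geoTau_theta a τ θ)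
  have h2 := (hasDerivAt_comp_geo_tau hXd).inner ℝ (hasDerivAt_dTheta_geo_tau a τ θ)
  simp only [hX.inner_geoTau_eq ha] at h1
  have h3 := (((Real.hasDerivAt_cos θ).const_mul (-(X !₂[0, 0, 1] 0))).sub
      ((Real.hasDerivAt_sin θ).const_mul (X !₂[0, 0, 1] 1))).const_mul √(meridianEnergy a τ)
  have h4 := h1.unique h3
  refine h2.congr_deriv ?_
  have hK := hX.inner_fderivWithin hp (geoTau_mem_tangentSpaceAt a τ θ)
    (dTheta_geo_mem_tangentSpaceAt a τ θ)
  linear_combination hK - h4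

theorem IsKilling.pole_coord_eq_zero (ha : 0 < a) (ha1 : a ≠ 1) (hX : IsKilling (ellipsoid a) X) :
    X !₂[0, 0, 1] 0 = 0 ∧ X !₂[0, 0, 1] 1 = 0 := by
  have hE0 : √(meridianEnergy a 0) = 1 := by simp [meridianEnergy]
  have h0 : ∀ θ, ⟪X (geo a 0 θ), geoTauTheta a 0 θ⟫ = 0 := fun θ => by simp [inner_three]
  have hq : HasDerivAt (fun τ => a ^ 2 * (Real.sin τ * Real.cos τ) / √(meridianEnergy a τ))
      (a ^ 2) 0 := by
    have h1 := ((Real.hasDerivAt_sin 0).mul (Real.hasDerivAt_cos 0)).const_mul (a ^ 2)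
    have h2 := (hasDerivAt_meridianEnergy a 0).sqrt (meridianEnergy_pos ha 0).ne'
    exact (h1.div h2 (by rw [hE0]; exact one_ne_zero)).congr_deriv (by simp [hE0])
  -- On the equator `geoTauTheta` is orthogonal to `X`. Comparing longitudes `θ` and `0`, the
  -- integrated formula gives the bracket with factor `a ^ 2`, the mixed Killing equation gives it
  -- with factor `1`.
  have key : ∀ θ, (a ^ 2 - 1) *
      (-(X !₂[0, 0, 1] 0) * Real.sin θ + X !₂[0, 0, 1] 1 * (Real.cos θ - 1)) = 0 := by
    intro θ
    have h1 := hX.hasDerivAt_inner_dTheta ha 0 θ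
    simp only [hX.inner_dTheta_sub_eq ha _ θ] at h1
    have h2 := (hX.hasDerivAt_inner_dTheta ha 0 0).add (hq.mul_const
      (-(X !₂[0, 0, 1] 0) * Real.sin θ + X !₂[0, 0, 1] 1 * (Real.cos θ - 1)))
    have h3 := h1.unique h2
    rw [h0, h0, hE0, Real.sin_zero, Real.cos_zero] at h3
    linear_combination -h3
  have hne : a ^ 2 - 1 ≠ 0 := by
    have : (a - 1) * (a + 1) ≠ 0 := mul_ne_zero (sub_ne_zero.2 ha1) (by positivity)
    intro h; apply this; linarith
  have k1 := (mul_eq_zero.1 (key Real.pi)).resolve_left hne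
  have k2 := (mul_eq_zero.1 (key (Real.pi / 2))).resolve_left hne
  simp only [Real.sin_pi, Real.cos_pi, Real.sin_pi_div_two, Real.cos_pi_div_two] at k1 k2
  constructor <;> linarith

/-- On an ellipsoid of revolution that is not a sphere every Killing field is a multiple of the
rotation field. -/
theorem IsKilling.exists_eq_smul_dTheta (ha : 0 < a) (ha1 : a ≠ 1)
    (hX : IsKilling (ellipsoid a) X) : ∃ c : ℝ, ∀ p ∈ ellipsoid a, X p = c • dTheta p := by
  obtain ⟨h0, h1⟩ := hX.pole_coord_eq_zero ha ha1
  have hτ : ∀ τ θ, ⟪X (geo a τ θ), geoTau a τ θ⟫ = 0 := fun τ θ => by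
    rw [hX.inner_geoTau_eq ha, h0, h1]; simp
  have hθ : ∀ τ θ, ⟪X (geo a τ θ), dTheta (geo a τ θ)⟫ = ⟪X (geo a τ 0), dTheta (geo a τ 0)⟫ :=
    fun τ θ => by rw [hX.inner_dTheta_sub_eq ha, h0, h1]; simp
  -- The mixed equation now reads `u' = -2 tan τ · u` for `u = ⟪X, ∂_θ⟫`, with solutions the
  -- multiples of `cos² τ`, that is, of `|∂_θ|²`.
  have hd : ∀ τ ∈ Ioo (-(Real.pi / 2)) (Real.pi / 2),
      HasDerivAt (fun τ => ⟪X (geo a τ 0), dTheta (geo a τ 0)⟫ / Real.cos τ ^ 2) 0 τ := by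
    intro τ hτ
    have hc := (Real.cos_pos_of_mem_Ioo hτ).ne'
    have h2 := hX.hasDerivAt_inner_dTheta ha τ 0
    refine (h2.div ((Real.hasDerivAt_cos τ).pow 2) (pow_ne_zero 2 hc)).congr_deriv ?_
    have := cos_mul_inner_geoTauTheta (a := a) (τ := τ) (θ := 0) (w := X (geo a τ 0))
    rw [h0, h1, div_eq_zero_iff]
    left
    simp only [Pi.pow_apply, Nat.cast_ofNat, Nat.add_one_sub_one, pow_one]
    linear_combination 2 * Real.cos τ * this
  have hconst : ∀ τ ∈ Ioo (-(Real.pi / 2)) (Real.pi / 2),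
      ⟪X (geo a τ 0), dTheta (geo a τ 0)⟫ =
        ⟪X (geo a 0 0), dTheta (geo a 0 0)⟫ * Real.cos τ ^ 2 := by
    intro τ hτ
    have h := isOpen_Ioo.is_const_of_deriv_eq_zero isPreconnected_Ioo
      (fun τ hτ => (hd τ hτ).differentiableAt.differentiableWithinAt)
      (fun τ hτ => (hd τ hτ).deriv) hτ
      (show (0 : ℝ) ∈ Ioo _ _ from ⟨by linarith [Real.pi_pos], by linarith [Real.pi_pos]⟩)
    have hc := (Real.cos_pos_of_mem_Ioo hτ).ne'
    simp only [Real.cos_zero, one_pow, div_one] at h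
    rwa [div_eq_iff (pow_ne_zero 2 hc)] at h
  refine ⟨⟪X (geo a 0 0), dTheta (geo a 0 0)⟫ / a ^ 2, fun p hp => ?_⟩
  obtain ⟨θ, hθp⟩ := exists_eq_geo ha hp
  have hXp := hX.1.2 p hp
  by_cases hc : Real.cos (Real.arcsin (p 2)) = 0
  · generalize Real.arcsin (p 2) = τ at hθp hc
    have hs : Real.sin τ ^ 2 = 1 := by have := Real.sin_sq_add_cos_sq τ; rw [hc] at this; linarith
    have hs0 : Real.sin τ ≠ 0 := by intro h; rw [h] at hs; norm_num at hs
    -- A pole lies on every meridian, so the radial component vanishes in all directions; the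
    -- directions `0` and `π / 2` suffice.
    have hp' : ∀ θ', p = geo a τ θ' := fun θ' => by
      rw [hθp]; exact ext_three (by simp [hc]) (by simp [hc]) (by simp)
    have hr : ∀ θ', Real.cos θ' * X p 0 + Real.sin θ' * X p 1 = 0 := by
      intro θ'
      have h := hτ τ θ'
      rw [← hp' θ'] at h
      have hh := energy_mul_radial (τ := τ) (θ := θ') ha (by rwa [← hp' θ'])
      rw [h, mul_zero] at hh
      exact (mul_eq_zero.1 hh).resolve_left (meridianEnergy_pos ha τ).ne'
    have hv : X p 2 = 0 := by
      have hh := energy_mul_vertical (τ := τ) (θ := θ) ha (by rwa [← hθp])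
      rw [hc, zero_mul] at hh
      exact (mul_eq_zero.1 hh).resolve_left (meridianEnergy_pos ha τ).ne'
    have e0 : p 0 = 0 := by rw [hθp]; simp [hc]
    have e1 : p 1 = 0 := by rw [hθp]; simp [hc]
    refine ext_three ?_ ?_ ?_
    · simpa [e1] using hr 0
    · simpa [e0] using hr (Real.pi / 2)
    · simpa using hv
  · have hmem : Real.arcsin (p 2) ∈ Ioo (-(Real.pi / 2)) (Real.pi / 2) := by
      refine ⟨lt_of_le_of_ne (Real.neg_pi_div_two_le_arcsin _) fun h => hc ?_,
        lt_of_le_of_ne (Real.arcsin_le_pi_div_two _) fun h => hc ?_⟩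
      · rw [← h]; simp
      · rw [h]; simp
    generalize Real.arcsin (p 2) = τ at hθp hc hmem
    subst hθp
    refine eq_smul_dTheta_of_inner ha hc hXp (hτ τ θ) ?_
    rw [hθ, hconst τ hmem]
    have := ha.ne'
    field_simp

end Killing

/-! ### The arc length of the meridians -/

section Meridian

variable {a : ℝ}

theorem continuous_sqrt_meridianEnergy (a : ℝ) : Continuous fun τ => √(meridianEnergy a τ) := by
  unfold meridianEnergy; fun_prop

theorem hasDerivAt_meridianArc (a t : ℝ) :
    HasDerivAt (meridianArc a) √(meridianEnergy a t) t :=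
  ((continuous_sqrt_meridianEnergy a).integral_hasStrictDerivAt 0 t).hasDerivAt

theorem contDiff_sqrt_meridianEnergy (ha : 0 < a) :
    ContDiff ℝ ∞ fun τ => √(meridianEnergy a τ) := by
  refine ContDiff.sqrt ?_ fun τ => (meridianEnergy_pos ha τ).ne'
  exact (contDiff_const.mul (Real.contDiff_sin.pow 2)).add (Real.contDiff_cos.pow 2)

theorem contDiff_meridianArc (ha : 0 < a) : ContDiff ℝ ∞ (meridianArc a) := by
  rw [contDiff_infty_iff_deriv]
  refine ⟨fun t => (hasDerivAt_meridianArc a t).differentiableAt, ?_⟩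
  rw [show deriv (meridianArc a) = fun τ => √(meridianEnergy a τ) from
    funext fun t => (hasDerivAt_meridianArc a t).deriv]
  exact contDiff_sqrt_meridianEnergy ha

theorem strictMono_meridianArc (ha : 0 < a) : StrictMono (meridianArc a) :=
  strictMono_of_deriv_pos fun t => by
    rw [(hasDerivAt_meridianArc a t).deriv]
    exact Real.sqrt_pos.2 (meridianEnergy_pos ha t)

theorem meridianArc_neg (a t : ℝ) : meridianArc a (-t) = -meridianArc a t := by
  have h := intervalIntegral.integral_comp_neg (a := 0) (b := t)
    fun τ => √(a ^ 2 * Real.sin τ ^ 2 + Real.cos τ ^ 2)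
  simp only [Real.sin_neg, Real.cos_neg, neg_sq, neg_zero] at h
  rw [meridianArc, meridianArc, intervalIntegral.integral_symm, ← h]

/-- The speed of the meridian is at least `min a 1`, so the arc length grows at least linearly in
both directions. -/
theorem surjective_meridianArc (ha : 0 < a) : Function.Surjective (meridianArc a) := by
  set c := min a 1 with hc
  have hc0 : 0 < c := lt_min ha one_pos
  have hmono : Monotone fun t => meridianArc a t - c * t := by
    have hd : ∀ t, HasDerivAt (fun t => meridianArc a t - c * t) (√(meridianEnergy a t) - c) t :=
      fun t => by
        simpa using (hasDerivAt_meridianArc a t).fun_sub ((hasDerivAt_id t).const_mul c)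
    refine monotone_of_deriv_nonneg (fun t => (hd t).differentiableAt) fun t => ?_
    rw [(hd t).deriv, sub_nonneg]
    apply Real.le_sqrt_of_sq_le
    have h1 : c ^ 2 ≤ a ^ 2 := pow_le_pow_left₀ hc0.le (min_le_left _ _) 2
    have h2 : c ^ 2 ≤ 1 := by simpa using pow_le_pow_left₀ hc0.le (min_le_right a 1) 2
    have h3 := Real.sin_sq_add_cos_sq t
    unfold meridianEnergy
    nlinarith [mul_le_mul_of_nonneg_right h1 (sq_nonneg (Real.sin t)),
      mul_le_mul_of_nonneg_right h2 (sq_nonneg (Real.cos t))]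
  have h0 : meridianArc a 0 = 0 := by simp [meridianArc]
  refine (contDiff_meridianArc ha).continuous.surjective ?_ ?_
  · refine Filter.tendsto_atTop_mono' _ ?_ (Filter.tendsto_id.const_mul_atTop hc0)
    filter_upwards [Filter.eventually_ge_atTop 0] with t ht
    have := hmono ht
    simp only [h0, mul_zero, sub_zero] at this
    simp only [id]; linarith
  · refine Filter.tendsto_atBot_mono' _ ?_ (Filter.tendsto_id.const_mul_atBot hc0)
    filter_upwards [Filter.eventually_le_atBot 0] with t ht
    have := hmono ht
    simp only [h0, mul_zero, sub_zero] at this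
    simp only [id]; linarith

/-- Since `meridianArc` is defined past the poles, its inverse is smooth on all of `ℝ`, with no
boundary case at `±d`. -/
theorem exists_contDiff_leftInverse_meridianArc (ha : 0 < a) :
    ∃ T : ℝ → ℝ, ContDiff ℝ ∞ T ∧ ∀ t, T (meridianArc a t) = t := by
  let e : ℝ ≃ₜ ℝ := ((strictMono_meridianArc ha).orderIsoOfSurjective _
    (surjective_meridianArc ha)).toHomeomorph
  refine ⟨e.symm, ?_, fun t => e.symm_apply_apply t⟩
  exact e.contDiff_symm_deriv (fun t => (Real.sqrt_pos.2 (meridianEnergy_pos ha t)).ne')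
    (fun t => hasDerivAt_meridianArc a t) (contDiff_meridianArc ha)

theorem meridianArc_arcsin_mem_Ioo (ha : 0 < a) {z : ℝ} (hz : |z| < 1) :
    meridianArc a (Real.arcsin z) ∈ Ioo (-halfMeridian a) (halfMeridian a) := by
  obtain ⟨h1, h2⟩ := abs_lt.1 hz
  have hs := strictMono_meridianArc ha
  rw [halfMeridian, ← meridianArc_neg]
  exact ⟨hs (Real.neg_pi_div_two_lt_arcsin.2 h1), hs (Real.arcsin_lt_pi_div_two.2 h2)⟩

end Meridian

/-! ### Fields `g ∂_θ` with a rotation invariant smooth function `g` on the ellipsoid -/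

section InvariantFactor

local notation "E3" => EuclideanSpace ℝ (Fin 3)

/-- `g` is a rotation invariant smooth function on the ellipsoid with `Z = g ∂_θ`. -/
structure IsInvariantFactor (a : ℝ) (Z : E3 → E3) (g : E3 → ℝ) : Prop where
  smooth : IsSmoothFunction (ellipsoid a) g
  eq_smul : ∀ p ∈ ellipsoid a, Z p = g p • dTheta p
  invariant : ∀ τ θ, g (geo a τ θ) = g (geo a τ 0)

variable {a : ℝ} {Z : E3 → E3} {g : E3 → ℝ}

theorem IsZonal.exists_isInvariantFactor (ha : 0 < a) (ha1 : a ≠ 1) (hZ : IsZonal (ellipsoid a) Z) :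
    ∃ g, IsInvariantFactor a Z g := by
  obtain ⟨⟨f, X, hf, hX, hfX⟩, hdiv, -⟩ := hZ
  obtain ⟨c, hc⟩ := hX.exists_eq_smul_dTheta ha ha1
  have hg : IsSmoothFunction (ellipsoid a) fun p => f p * c := hf.mul contDiffOn_const
  have hZg : ∀ p ∈ ellipsoid a, Z p = (f p * c) • dTheta p := fun p hp => by
    rw [hfX p hp, hc p hp, smul_smul]
  refine ⟨fun p => f p * c, hg, hZg, fun τ θ => ?_⟩
  have hd : ∀ θ, HasDerivAt (fun θ => f (geo a τ θ) * c) 0 θ := fun θ => by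
    have hp := geo_mem a τ θ
    have h := hasDerivAt_comp_geo_theta (hg.differentiableWithinAt hp)
    rwa [← (isKilling_dTheta ha).divergence_smul hg hZg hp, hdiv.2 _ hp] at h
  exact is_const_of_deriv_eq_zero (fun θ => (hd θ).differentiableAt) (fun θ => (hd θ).deriv) θ 0

namespace IsInvariantFactor

theorem eq_geo_arcsin (ha : 0 < a) (hg : IsInvariantFactor a Z g) {p : E3}
    (hp : p ∈ ellipsoid a) : g p = g (geo a (Real.arcsin (p 2)) 0) := by
  obtain ⟨θ, hθ⟩ := exists_eq_geo ha hp
  conv_lhs => rw [hθ]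
  exact hg.invariant _ θ

theorem fderivWithin_dTheta (ha : 0 < a) (hg : IsInvariantFactor a Z g) {p : E3}
    (hp : p ∈ ellipsoid a) : fderivWithin ℝ g (ellipsoid a) p (dTheta p) = 0 := by
  obtain ⟨θ, hθ⟩ := exists_eq_geo ha hp
  generalize Real.arcsin (p 2) = τ at hθ
  subst hθ
  have h := hasDerivAt_comp_geo_theta (hg.smooth.differentiableWithinAt hp)
  have hc : (fun θ => g (geo a τ θ)) = fun _ => g (geo a τ 0) := funext fun θ => hg.invariant τ θ
  rw [hc] at h
  exact h.unique (hasDerivAt_const _ _)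

theorem isVectorField (ha : 0 < a) (hg : IsInvariantFactor a Z g) :
    IsVectorField (ellipsoid a) Z := by
  refine ⟨(ContDiffOn.smul hg.smooth (isVectorField_dTheta ha).1).congr hg.eq_smul, fun p hp => ?_⟩
  rw [hg.eq_smul p hp]
  exact Submodule.smul_mem _ _ ((isVectorField_dTheta ha).2 p hp)

theorem isDivergenceFree (ha : 0 < a) (hg : IsInvariantFactor a Z g) :
    IsDivergenceFree (ellipsoid a) Z :=
  ⟨hg.isVectorField ha, fun p hp => by
    rw [(isKilling_dTheta ha).divergence_smul hg.smooth hg.eq_smul hp,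
      hg.fderivWithin_dTheta ha hp]⟩

/-- The derivative of `g` along `Z` vanishes by invariance, so only `∂_θ` is differentiated. -/
theorem fderivWithin_self (ha : 0 < a) (hg : IsInvariantFactor a Z g) {p : E3}
    (hp : p ∈ ellipsoid a) :
    fderivWithin ℝ Z (ellipsoid a) p (Z p) = g p ^ 2 • dTheta (dTheta p) := by
  rw [fderivWithin_smul_of_eqOn hp (hg.smooth.differentiableWithinAt hp)
    ((isKilling_dTheta ha).1.differentiableWithinAt hp) hg.eq_smul ((hg.isVectorField ha).2 p hp),
    fderivWithin_eq_of_mem_tangentSpaceAt (hasFDerivAt_dTheta p).hasFDerivWithinAt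
      ((hg.isVectorField ha).2 p hp), hg.eq_smul p hp, map_smul, map_smul,
    hg.fderivWithin_dTheta ha hp, dThetaCLM_apply, smul_smul, pow_two]
  simp

theorem continuous_comp_geo (hg : IsInvariantFactor a Z g) (θ : ℝ) :
    Continuous fun τ => g (geo a τ θ) :=
  continuous_iff_continuousAt.2 fun τ =>
    (hasDerivAt_comp_geo_tau (hg.smooth.differentiableWithinAt (geo_mem a τ θ))).continuousAt

/-- The potential of `∇_Z Z`. -/
theorem exists_potential (ha : 0 < a) (hg : IsInvariantFactor a Z g) :
    ∃ q, IsSmoothFunction (ellipsoid a) q ∧ ∀ p ∈ ellipsoid a, ∀ w ∈ tangentSpaceAt (ellipsoid a) p,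
      fderivWithin ℝ q (ellipsoid a) p w = a ^ 2 * p 2 * g p ^ 2 * w 2 := by
  -- By invariance `g` is a function of `z` alone. As `arcsin` is singular at `±1`, only continuity
  -- of `h` is available here.
  let h : ℝ → ℝ := fun z => a ^ 2 * z * g (geo a (Real.arcsin z) 0) ^ 2
  have hh : Continuous h := by
    have := (hg.continuous_comp_geo 0).comp Real.continuous_arcsin
    exact (continuous_const.mul continuous_id).mul (this.pow 2)
  have hgh : ∀ p ∈ ellipsoid a, h (p 2) = a ^ 2 * p 2 * g p ^ 2 := fun p hp => by
    rw [hg.eq_geo_arcsin ha hp]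
  let Q : ℝ → ℝ := fun z => ∫ s in (0 : ℝ)..z, h s
  have hQ : ∀ z, HasDerivAt Q (h z) z := fun z => (hh.integral_hasStrictDerivAt 0 z).hasDerivAt
  refine ⟨fun p => Q (p 2), ?_, fun p hp w hw => ?_⟩
  · apply contDiffOn_of_contDiffOn_comp_centralProj ha
    have hop : IsOpen ({0}ᶜ : Set E3) := isOpen_compl_singleton
    have hz : ContDiffOn ℝ ∞ (fun p : E3 => centralProj a p 2) {0}ᶜ :=
      (contDiff_coord 2).comp_contDiffOn (contDiffOn_centralProj ha)
    -- Although `Q` is only known to be `C¹`, the derivative of its pullback is written with the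
    -- smooth function `g` in place of `h`, so the pullback is `C^∞`.
    have hD : ∀ p ∈ ({0}ᶜ : Set E3), HasFDerivAt (fun p => Q (centralProj a p 2))
        ((a ^ 2 * centralProj a p 2 * g (centralProj a p) ^ 2) •
          fderiv ℝ (fun p : E3 => centralProj a p 2) p) p := fun p hp => by
      rw [← hgh _ (centralProj_mem ha hp)]
      exact (hQ _).comp_hasFDerivAt p
        ((hz.differentiableOn (by simp)).differentiableAt (hop.mem_nhds hp)).hasFDerivAt
    rw [contDiffOn_infty_iff_fderiv_of_isOpen hop]
    refine ⟨fun p hp => (hD p hp).differentiableAt.differentiableWithinAt,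
      ContDiffOn.congr ?_ fun p hp => (hD p hp).fderiv⟩
    exact ((contDiffOn_const.mul hz).mul ((contDiffOn_comp_centralProj ha hg.smooth).pow 2)).smul
      ((contDiffOn_infty_iff_fderiv_of_isOpen hop).1 hz).2
  · have hd : HasFDerivAt (fun p : E3 => Q (p 2))
        (h (p 2) • (EuclideanSpace.proj (𝕜 := ℝ) 2 : E3 →L[ℝ] ℝ)) p :=
      (hQ _).comp_hasFDerivAt p (EuclideanSpace.proj (𝕜 := ℝ) 2 : E3 →L[ℝ] ℝ).hasFDerivAt
    rw [fderivWithin_eq_of_mem_tangentSpaceAt hd.hasFDerivWithinAt hw, hgh p hp]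
    simp

theorem isLerayProjection_zero (ha : 0 < a) (hg : IsInvariantFactor a Z g) :
    IsLerayProjection (ellipsoid a) (fun p => cov (ellipsoid a) Z p (Z p)) 0 := by
  -- The zero field has invariant factor `0`, so it is divergence-free by the general case.
  have h0 : IsInvariantFactor a (0 : E3 → E3) (fun _ => 0) :=
    ⟨contDiffOn_const, fun p _ => by simp, fun _ _ => rfl⟩
  obtain ⟨q, hq, hdq⟩ := hg.exists_potential ha
  refine ⟨h0.isDivergenceFree ha, q, hq, fun p hp => ?_⟩
  set T := tangentSpaceAt (ellipsoid a) p
  simp only [Pi.zero_apply, cov]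
  rw [eq_comm, grad, ← map_sub, hg.fderivWithin_self ha hp,
    Submodule.starProjection_apply_eq_zero_iff, Submodule.mem_orthogonal']
  intro w hw
  rw [inner_sub_left, gradientWithin, InnerProductSpace.toDual_symm_apply, hdq p hp w hw]
  rw [mem_tangentSpaceAt_ellipsoid_iff ha hp] at hw
  simp [inner_three]
  linear_combination -g p ^ 2 * hw

theorem isZonal (ha : 0 < a) (hg : IsInvariantFactor a Z g) : IsZonal (ellipsoid a) Z :=
  ⟨⟨g, dTheta, hg.smooth, isKilling_dTheta ha, hg.eq_smul⟩, hg.isDivergenceFree ha,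
    hg.isLerayProjection_zero ha⟩

theorem isCircleZonal (ha : 0 < a) (hg : IsInvariantFactor a Z g) :
    IsCircleZonal (ellipsoid a) Z :=
  ⟨hg.isZonal ha, g, dTheta, hg.smooth, isKilling_dTheta ha, hg.eq_smul,
    isInducedByCircleAction_dTheta⟩

theorem isProfileField (ha : 0 < a) (hg : IsInvariantFactor a Z g) : IsProfileField a Z := by
  obtain ⟨T, hT, hTm⟩ := exists_contDiff_leftInverse_meridianArc ha
  refine ⟨hg.isVectorField ha, fun r => g (geo a (T r) 0), ?_, fun p hp => ?_⟩
  · refine ContDiffOn.comp hg.smooth (ContDiff.contDiffOn ?_) fun r _ => geo_mem a (T r) 0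
    rw [contDiff_euclidean]
    intro i
    fin_cases i
    · exact contDiff_const.mul ((Real.contDiff_cos.comp hT).mul contDiff_const)
    · exact contDiff_const.mul ((Real.contDiff_cos.comp hT).mul contDiff_const)
    · exact Real.contDiff_sin.comp hT
  · simp only [rCoord, hTm]
    rw [← hg.eq_geo_arcsin ha hp]
    exact hg.eq_smul p hp

theorem eq_zero_of_geodesic (ha : 0 < a) (hg : IsInvariantFactor a Z g)
    (hgeo : ∀ p ∈ ellipsoid a, cov (ellipsoid a) Z p (Z p) = 0) {p : E3} (hp : p ∈ ellipsoid a) :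
    Z p = 0 := by
  have key : ∀ τ θ, Real.sin τ * Real.cos τ ≠ 0 → g (geo a τ θ) = 0 := by
    intro τ θ hne
    have hq := geo_mem a τ θ
    have h := congrArg (fun u => ⟪u, geoTau a τ θ⟫) (hgeo _ hq)
    simp only [inner_zero_left] at h
    rw [cov, inner_starProjection_tangent (geoTau_mem_tangentSpaceAt a τ θ),
      hg.fderivWithin_self ha hq, inner_smul_left] at h
    have hi : ⟪dTheta (dTheta (geo a τ θ)), geoTau a τ θ⟫ =
        a ^ 2 * (Real.sin τ * Real.cos τ) := by
      simp [inner_three]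
      linear_combination a ^ 2 * (Real.sin τ * Real.cos τ) * Real.sin_sq_add_cos_sq θ
    rw [hi] at h
    have hne' : a ^ 2 * (Real.sin τ * Real.cos τ) ≠ 0 := mul_ne_zero (by positivity) hne
    simpa using (mul_eq_zero.1 h).resolve_right hne'
  obtain ⟨θ, hθ⟩ := exists_eq_geo ha hp
  generalize Real.arcsin (p 2) = τ at hθ
  subst hθ
  rw [hg.eq_smul _ hp]
  by_cases hne : Real.sin τ * Real.cos τ = 0
  -- The zeros of `sin τ cos τ` are simple, since its derivative is `cos² τ - sin² τ`. They are
  -- therefore isolated, and `g` vanishes there as a limit along the meridian.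
  · have hd := (Real.hasDerivAt_sin τ).fun_mul (Real.hasDerivAt_cos τ)
    have hd0 : Real.cos τ * Real.cos τ + Real.sin τ * -Real.sin τ ≠ 0 := by
      have h1 := Real.sin_sq_add_cos_sq τ
      intro h2
      rcases mul_eq_zero.1 hne with h | h <;> rw [h] at h1 h2 <;> nlinarith
    have hev : ∀ᶠ τ' in nhdsWithin τ {τ}ᶜ, g (geo a τ' θ) = 0 := by
      filter_upwards [hd.eventually_ne hd0 (c := 0)] with τ' h' using key τ' θ h'
    have hlim := (hg.continuous_comp_geo θ).continuousAt.tendsto.mono_left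
      (nhdsWithin_le_nhds (a := τ) (s := {τ}ᶜ))
    rw [tendsto_nhds_unique hlim (tendsto_const_nhds.congr' (hev.mono fun _ h => h.symm)), zero_smul]
  · rw [key τ θ hne, zero_smul]

end IsInvariantFactor

end InvariantFactor

/-! ### Smoothness of the factor of `∂_θ` at the poles -/

section Poles

local notation "E3" => EuclideanSpace ℝ (Fin 3)

/-- Scaling of the first coordinate. -/
def shear (x : E3 × ℝ) : E3 := !₂[x.2 * x.1 0, x.1 1, x.1 2]

@[simp] theorem shear_zero_coord (x : E3 × ℝ) : shear x 0 = x.2 * x.1 0 := rfl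
@[simp] theorem shear_one_coord (x : E3 × ℝ) : shear x 1 = x.1 1 := rfl
@[simp] theorem shear_two_coord (x : E3 × ℝ) : shear x 2 = x.1 2 := rfl

theorem contDiff_shear : ContDiff ℝ ∞ shear := by
  have h (i : Fin 3) : ContDiff ℝ ∞ fun x : E3 × ℝ => x.1 i := (contDiff_coord i).comp contDiff_fst
  rw [contDiff_euclidean]
  intro i
  fin_cases i
  · exact contDiff_snd.mul (h 0)
  · exact h 1
  · exact h 2

theorem hasDerivAt_shear (p : E3) (t : ℝ) :
    HasDerivAt (fun t => shear (p, t)) (p 0 • !₂[1, 0, 0]) t := by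
  apply hasDerivAt_three
  · simpa using (hasDerivAt_id t).mul_const (p 0)
  · simpa using hasDerivAt_const t (p 1)
  · simpa using hasDerivAt_const t (p 2)

theorem isOpen_coord_two_ne_zero : IsOpen {p : E3 | p 2 ≠ 0} :=
  isOpen_ne_fun (contDiff_coord 2).continuous continuous_const

/-- Hadamard's lemma: a smooth function that vanishes where `p 0 = 0` is divisible by `p 0`,
away from the plane `p 2 = 0`. -/
theorem exists_contDiffOn_eq_mul_coord_zero {W : E3 → ℝ} (hW : ContDiffOn ℝ ∞ W {0}ᶜ)
    (hW0 : ∀ p, p 2 ≠ 0 → p 0 = 0 → W p = 0) :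
    ∃ G : E3 → ℝ, ContDiffOn ℝ ∞ G {p | p 2 ≠ 0} ∧ ∀ p, p 2 ≠ 0 → W p = p 0 * G p := by
  have hop : IsOpen ({0}ᶜ : Set E3) := isOpen_compl_singleton
  let F : E3 × ℝ → ℝ := fun x => fderiv ℝ W (shear x) !₂[1, 0, 0]
  -- The segment from `(0, y, z)` to `(x, y, z)` avoids the origin because `z ≠ 0`; integrating the
  -- `x`-derivative of `W` along it gives the quotient.
  have hmaps : ∀ x ∈ {p : E3 | p 2 ≠ 0} ×ˢ (univ : Set ℝ), shear x ∈ ({0}ᶜ : Set E3) := by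
    rintro x ⟨hx, -⟩ h
    apply hx
    rw [← shear_two_coord, mem_singleton_iff.1 h]; rfl
  have hF : ContDiffOn ℝ ∞ F ({p : E3 | p 2 ≠ 0} ×ˢ univ) :=
    (((contDiffOn_infty_iff_fderiv_of_isOpen hop).1 hW).2.comp contDiff_shear.contDiffOn
      hmaps).clm_apply contDiffOn_const
  refine ⟨fun p => ∫ t in (0 : ℝ)..1, F (p, t),
    contDiffOn_intervalIntegral isOpen_coord_two_ne_zero hF 0 1, fun p hp => ?_⟩
  have hd : ∀ t, HasDerivAt (fun t => W (shear (p, t))) (p 0 * F (p, t)) t := fun t => by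
    have h := ((hW.differentiableOn (by simp)).differentiableAt
      (hop.mem_nhds (hmaps (p, t) ⟨hp, mem_univ _⟩))).hasFDerivAt.comp_hasDerivAt t
      (hasDerivAt_shear p t)
    rwa [map_smul] at h
  have hint := intervalIntegral.integral_eq_sub_of_hasDerivAt (a := 0) (b := 1)
    (fun t _ => hd t)
    ((continuous_slice (hF.continuousOn) hp).const_mul (p 0) |>.intervalIntegrable 0 1)
  have h1 : shear (p, 1) = p := ext_three (by simp) rfl rfl
  rw [intervalIntegral.integral_const_mul, h1, hW0 (shear (p, 0)) hp (by simp), sub_zero] at hint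
  exact hint.symm

variable {a : ℝ} {Z : E3 → E3}

theorem rCoord_geo (a τ θ : ℝ) : rCoord a (geo a τ θ) = meridianArc a (Real.arcsin (Real.sin τ)) :=
  rfl

theorem exists_factor_near_poles (ha : 0 < a) (hZ : IsVectorField (ellipsoid a) Z) {f : ℝ → ℝ}
    (hf : ∀ p ∈ ellipsoid a, Z p = f (rCoord a p) • dTheta p) :
    ∃ G : E3 → ℝ, ContDiffOn ℝ ∞ G {p | p 2 ≠ 0} ∧
      ∀ p ∈ ellipsoid a, p 2 ≠ 0 → |p 2| < 1 → f (rCoord a p) = G p := by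
  let W : E3 → ℝ := fun p => Z (centralProj a p) 1
  have hW : ContDiffOn ℝ ∞ W {0}ᶜ :=
    (contDiff_coord 1).comp_contDiffOn (contDiffOn_comp_centralProj ha hZ.1)
  have hW' : ∀ p ∈ ellipsoid a, W p = p 0 * f (rCoord a p) := fun p hp => by
    simp only [W, centralProj_of_mem ha hp, hf p hp]
    simp [mul_comm]
  have hW0 : ∀ p, p 2 ≠ 0 → p 0 = 0 → W p = 0 := fun p h2 hp => by
    have h : p ≠ 0 := fun h => h2 (by simp [h])
    simp only [W, hf _ (centralProj_mem ha h)]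
    simp [centralProj, hp]
  obtain ⟨G, hG, hWG⟩ := exists_contDiffOn_eq_mul_coord_zero hW hW0
  have hne : ∀ p ∈ ellipsoid a, p 2 ≠ 0 → p 0 ≠ 0 → f (rCoord a p) = G p := fun p hp h2 h0 =>
    mul_left_cancel₀ h0 ((hW' p hp).symm.trans (hWG p h2))
  refine ⟨G, hG, fun p hp h2 h1 => ?_⟩
  by_cases h0 : p 0 = 0
  · obtain ⟨θ, hθ⟩ := exists_eq_geo ha hp
    have hcos : 0 < Real.cos (Real.arcsin (p 2)) := by
      rw [Real.cos_arcsin]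
      exact Real.sqrt_pos.2 (by linarith [(sq_lt_one_iff_abs_lt_one (p 2)).2 h1])
    generalize Real.arcsin (p 2) = τ at hθ hcos
    subst hθ
    have hc : Real.cos θ = 0 := by
      have := (mul_eq_zero.1 h0).resolve_left ha.ne'
      exact (mul_eq_zero.1 this).resolve_left hcos.ne'
    have hs : -Real.sin θ ≠ 0 := fun h => by
      have := Real.sin_sq_add_cos_sq θ
      rw [hc, neg_eq_zero.1 h] at this; norm_num at this
    -- Along a parallel `f(r)` is constant and `G` is continuous, so the equality passes from nearby
    -- points with `x ≠ 0` to the point with `x = 0`.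
    have hev : ∀ᶠ θ' in nhdsWithin θ {θ}ᶜ, f (rCoord a (geo a τ θ)) = G (geo a τ θ') := by
      filter_upwards [(Real.hasDerivAt_cos θ).eventually_ne hs (c := 0)] with θ' h'
      exact hne (geo a τ θ') (geo_mem a τ θ') h2 (mul_ne_zero ha.ne' (mul_ne_zero hcos.ne' h'))
    have hcont : ContinuousAt (fun θ => G (geo a τ θ)) θ :=
      ContinuousAt.comp (g := G) (hG.continuousOn.continuousAt
        (isOpen_coord_two_ne_zero.mem_nhds h2)) (hasDerivAt_geo_theta a τ θ).continuousAt
    have hlim := hcont.tendsto.mono_left (nhdsWithin_le_nhds (a := θ) (s := {θ}ᶜ))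
    exact tendsto_nhds_unique (tendsto_const_nhds.congr' hev) hlim
  · exact hne p hp h2 h0

/-- The factor is `f(r)` away from the poles, where `r` is smooth, and the Hadamard quotient `G` at
the poles. The two agree on the ellipsoid near the poles, so smoothness there is inherited from `G`.
-/
theorem IsProfileField.exists_isInvariantFactor (ha : 0 < a) (hZ : IsProfileField a Z) :
    ∃ g, IsInvariantFactor a Z g := by
  obtain ⟨hV, f, hf, hZf⟩ := hZ
  obtain ⟨G, hG, hfG⟩ := exists_factor_near_poles ha hV hZf
  have hpole : ∀ p ∈ ellipsoid a, ¬ |p 2| < 1 → p 0 = 0 ∧ p 1 = 0 := fun p hp h => by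
    have h2 : p 2 ^ 2 = 1 := le_antisymm (sq_coord_two_le ha hp)
      (not_lt.1 fun h' => h ((sq_lt_one_iff_abs_lt_one (p 2)).1 h'))
    simp only [ellipsoid, mem_ofPred_eq, h2] at hp
    constructor <;> nlinarith [sq_nonneg (p 0), sq_nonneg (p 1)]
  classical
  refine ⟨fun p => if |p 2| < 1 then f (rCoord a p) else G p, ?_, fun p hp => ?_, fun τ θ => ?_⟩
  · intro p hp
    by_cases h : |p 2| < 1
    · have hop : IsOpen {p : E3 | |p 2| < 1} :=
        isOpen_lt (contDiff_coord 2).continuous.abs continuous_const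
      refine ContDiffAt.contDiffWithinAt ?_
      have hr : ContDiffAt ℝ ∞ (rCoord a) p := by
        obtain ⟨h1, h2⟩ := abs_lt.1 h
        have hasin : ContDiffAt ℝ ∞ (fun p : E3 => Real.arcsin (p 2)) p :=
          ContDiffAt.comp (g := Real.arcsin) p (Real.contDiffAt_arcsin h1.ne' h2.ne)
            (contDiff_coord 2).contDiffAt
        exact (contDiff_meridianArc ha).contDiffAt.comp p hasin
      have hfr : ContDiffAt ℝ ∞ (fun p => f (rCoord a p)) p :=
        (hf.contDiffAt (isOpen_Ioo.mem_nhds (meridianArc_arcsin_mem_Ioo ha h))).comp p hr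
      refine hfr.congr_of_eventuallyEq ?_
      filter_upwards [hop.mem_nhds h] with q hq using if_pos hq
    · have h2 : p 2 ≠ 0 := fun h0 => h (by simp [h0])
      have hU := isOpen_coord_two_ne_zero.mem_nhds h2
      have hGp : ContDiffWithinAt ℝ ∞ G (ellipsoid a) p :=
        (hG.contDiffAt hU).contDiffWithinAt
      refine hGp.congr_of_eventuallyEq ?_ (if_neg h)
      filter_upwards [self_mem_nhdsWithin, nhdsWithin_le_nhds hU] with q hq hq2
      by_cases hq1 : |q 2| < 1
      · rw [if_pos hq1, hfG q hq hq2 hq1]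
      · rw [if_neg hq1]
  · by_cases h : |p 2| < 1
    · simp only [if_pos h]; exact hZf p hp
    · obtain ⟨h0, h1⟩ := hpole p hp h
      have hd : dTheta p = 0 := ext_three (by simp [h1]) (by simp [h0]) (by simp)
      rw [hZf p hp, hd, smul_zero, smul_zero]
  · by_cases h : |Real.sin τ| < 1
    · beta_reduce
      rw [geo_two_coord, geo_two_coord, if_pos h, if_pos h, rCoord_geo, rCoord_geo]
    · have h' (θ : ℝ) := hpole (geo a τ θ) (geo_mem a τ θ) h
      rw [show geo a τ θ = geo a τ 0 from
        ext_three ((h' θ).1.trans (h' 0).1.symm) ((h' θ).2.trans (h' 0).2.symm) rfl]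

end Poles

end ZonalFlow

end

theorem mainTheorem6 (a : ℝ) (ha : 0 < a) (ha1 : a ≠ 1)
    (Z : EuclideanSpace ℝ (Fin 3) → EuclideanSpace ℝ (Fin 3)) :
    (ZonalFlow.IsZonal (ZonalFlow.ellipsoid a) Z ↔ ZonalFlow.IsProfileField a Z) ∧
    (ZonalFlow.IsZonal (ZonalFlow.ellipsoid a) Z → (∃ p ∈ ZonalFlow.ellipsoid a, Z p ≠ 0) →
      ¬ ZonalFlow.IsGeodesicZonal (ZonalFlow.ellipsoid a) Z ∧
      ZonalFlow.IsCircleZonal (ZonalFlow.ellipsoid a) Z) := by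
  refine ⟨⟨fun h => ?_, fun h => ?_⟩, fun h hne => ?_⟩
  · obtain ⟨g, hg⟩ := h.exists_isInvariantFactor ha ha1
    exact hg.isProfileField ha
  · obtain ⟨g, hg⟩ := h.exists_isInvariantFactor ha
    exact hg.isZonal ha
  · obtain ⟨g, hg⟩ := h.exists_isInvariantFactor ha ha1
    obtain ⟨p, hp, hpne⟩ := hne
    exact ⟨fun hgeo => hpne (hg.eq_zero_of_geodesic ha hgeo.2 hp), hg.isCircleZonal ha⟩
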